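/- For $N\in\mathbb N=\{1,2,\dots\}$ and $1\le p\le\infty$ let $l_p^N$ be $\mathbb R^N$ with the norm $\|x\|_{l_p^N}=\bigl(\sum_{i=1}^N|x_i|^p\bigr)^{1/p}$ ($\max_i|x_i|$ if $p=\infty$), and let $B_p^N$ be its closed unit ball; let $p'$ be given by $\frac1p+\frac1{p'}=1$. For a normed space $X$, a nonempty set $M\subset X$ and an integer $n\ge 0$ the Gelfand $n$-width of $M$ in $X$ is $$d^n(M,X)=\inf_{x_1^*,\dots,x_n^*\in X^*}\ \sup\Bigl\{\|x\|:\ x\in M\cap\bigcap_{j=1}^n\ker x_j^*\Bigr\}.$$ Theorem. For every $p_1\in(1,2)$ there are constants $c,C>0$ depending only on $p_1$ such that the following holds. Let $2\le q\le\infty$, let $r\ge1$, let $p_1\le p_2\le\dots\le p_r\le q$, let $N\in\mathbb N$, let $n\ge 0$ be an integer with $n\le N/2$, and let $\nu_1,\dots,\nu_r>0$ satisfy $$\nu_1\ge\nu_2\ge\dots\ge\nu_r,\qquad \nu_1N^{-1/p_1}\le\nu_2N^{-1/p_2}\le\dots\le\nu_rN^{-1/p_r}$$ (with $1/\infty=0$).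 Then $$c\,\min\{\nu_1n^{-1/2}N^{1/p_1'},\,\nu_r\}\ \le\ d^n\Bigl(\bigcap_{j=1}^r\nu_jB_{p_j}^N,\ l_q^N\Bigr)\ \le\ C\,\min\{\nu_1n^{-1/2}N^{1/p_1'},\,\nu_r\},$$ where for $n=0$ we put $n^{-1/2}=+\infty$, so that the minimum equals $\nu_r$. -/

import Mathlib

open scoped ENNReal Pointwise

/-- The Gelfand `n`-width `d^n(M, X)` of a set `M` in a real normed space `X`: the infimum over all
`n`-tuples of continuous linear functionals of the supremum of the norm on the part of `M` on which
they all vanish. Values are taken in `[0, ∞]`, so neither the infimum nor the supremum has a junk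
value. -/
noncomputable def gelfandWidth {X : Type*} [NormedAddCommGroup X] [NormedSpace ℝ X]
    (n : ℕ) (M : Set X) : ℝ≥0∞ :=
  ⨅ f : Fin n → StrongDual ℝ X, ⨆ x ∈ M ∩ {x : X | ∀ i, f i x = 0}, ‖x‖ₑ

/-- The closed unit ball `B_p^N` of `l_p^N`, as a subset of `ℝ^N`. -/
def lpUnitBall (N : ℕ) (p : ℝ≥0∞) : Set (Fin N → ℝ) :=
  {x | ‖(WithLp.toLp p x : PiLp p fun _ : Fin N => ℝ)‖ ≤ 1}

/-- The intersection of the balls `ν_j B_{p_j}^N`, viewed as a subset of the normed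
space `l_q^N` (that is, `PiLp q fun _ : Fin N => ℝ`). -/
def ballsInter {ι : Type*} (N : ℕ) (q : ℝ≥0∞) (p : ι → ℝ≥0∞) (ν : ι → ℝ) :
    Set (PiLp q fun _ : Fin N => ℝ) :=
  {x | WithLp.ofLp x ∈ ⋂ j, ν j • lpUnitBall N (p j)}

/-- `min {ν₁ n^{-1/2} N^{1/p₁'}, ν_r}`, where `p₁'` is the exponent conjugate to `p₁`. It is computed
in `[0, ∞]`, where `n^{-1/2} = ∞` for `n = 0`, so that the minimum is then `ν_r`. -/
noncomputable def widthRate (n N : ℕ) (p₁ : ℝ≥0∞) (ν₁ νr : ℝ) : ℝ≥0∞ :=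
  min (ENNReal.ofReal ν₁ * (n : ℝ≥0∞) ^ (-(1 / 2) : ℝ)
      * (N : ℝ≥0∞) ^ (1 / ENNReal.conjExponent p₁).toReal)
    (ENNReal.ofReal νr)

/-! Upper bound. The intersection lies in `ν_r` times the unit ball of `l_q`, because `p_r ≤ q`. It
also lies in `ν_1 B_{p_1}`, and the `l_q`-norm is at most the `l_2`-norm. So it suffices to find n
functionals on whose common kernel `√n ‖x‖_2 ≲ N^θ ‖x‖_p`, where `p = p_1` and `θ = 1 - 1/p`
(`exists_functionals_norm_le`). The rows of a suitable sign matrix Λ do this.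

There are at most `exp (K W)` integer points of `l_1`-norm at most m, where `W = m^{1-θ} N^θ`.
Exponential moments of Rademacher sums and a union bound then give one matrix
(`exists_signMap_bounds`) that is bounded above on all `{0, ±1}`-vectors, at the cost of a term W,
and bounded below on integer vectors with `W ≤ c n`.

Let `‖x‖_p ≤ 1` and `Λ x = 0`, and let y be x rounded towards zero on the grid of mesh `a = N^θ / (c
n)`. Then `y / a` is sparse enough for the lower bound, so `n ‖y‖_2² ≲ ‖Λ y‖²`. Since `Λ x = 0`, `Λ
y` is minus the sum of the images of the dyadic layers of `x - y`, each of which is a multiple of a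
`{0, ±1}`-vector. The layer of mesh b contributes `√n b^{1-p/2}`, which is geometric because `p <
2`, plus `N^θ` times a factor that decays away from `b = N^{-1/p}` because `p > 1`. In total `‖Λ y‖
≲ N^θ`. The remainder satisfies `‖x - y‖_2² ≤ a^{2-p}`, which is also small enough
(`sum_sq_le_of_bounds`).

Lower bound. The orthogonal complement of a common kernel has dimension at most n, so by the trace
of its projection some unit vector `e_i` has projection w with `‖w‖² = w_i ≤ n / N ≤ 1/2`. The
vector `e_i - w` lies in the kernel, has a coordinate at least 1/2, and has small norms in every
`l_p`; a multiple of it lies in all the balls (`exists_spread_vector`). -/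

/-! ### Moments of Rademacher sums. -/

/-- The real number `±1` encoded by a Boolean. -/
def boolSign (b : Bool) : ℝ := if b then 1 else -1

/-- The signed sum `∑ ±z_i`. -/
def signSum {N : ℕ} (ε : Fin N → Bool) (z : Fin N → ℝ) : ℝ := ∑ i, boolSign (ε i) * z i

/-- Summing over all sign vectors by conditioning on all but the first sign. -/
theorem sum_comp_signSum_succ {N : ℕ} (f : ℝ → ℝ) (z : Fin (N + 1) → ℝ) :
    ∑ ε : Fin (N + 1) → Bool, f (signSum ε z) =
      ∑ ε : Fin N → Bool, (f (signSum ε (Fin.tail z) + z 0) +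
        f (signSum ε (Fin.tail z) - z 0)) := by
  rw [← (Fin.consEquiv fun _ : Fin (N + 1) => Bool).sum_comp, Fintype.sum_prod_type_right]
  refine Finset.sum_congr rfl fun ε _ => ?_
  have h : ∀ b : Bool, signSum (Fin.cons b ε : Fin (N + 1) → Bool) z =
      boolSign b * z 0 + signSum ε (Fin.tail z) := by
    intro b
    simp [signSum, Fin.sum_univ_succ, Fin.tail]
  rw [Fintype.sum_bool]
  change f (signSum (Fin.cons true ε : Fin (N + 1) → Bool) z) +
    f (signSum (Fin.cons false ε : Fin (N + 1) → Bool) z) = _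
  rw [h, h]
  simp only [boolSign, if_true, Bool.false_eq_true, if_false]
  congr 1 <;> congr 1 <;> ring

theorem sum_sq_succ {N : ℕ} (z : Fin (N + 1) → ℝ) :
    ∑ i, z i ^ 2 = z 0 ^ 2 + ∑ i, Fin.tail z i ^ 2 := by
  simp [Fin.sum_univ_succ, Fin.tail]

theorem sum_signSum_sq : ∀ {N : ℕ} (z : Fin N → ℝ),
    ∑ ε : Fin N → Bool, signSum ε z ^ 2 = 2 ^ N * ∑ i, z i ^ 2
  | 0, z => by simp [signSum]
  | N + 1, z => by
    rw [sum_comp_signSum_succ (fun t => t ^ 2), sum_sq_succ]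
    have h := sum_signSum_sq (Fin.tail z)
    calc _ = ∑ ε : Fin N → Bool, (2 * signSum ε (Fin.tail z) ^ 2 + 2 * z 0 ^ 2) :=
          Finset.sum_congr rfl fun ε _ => by ring
      _ = _ := by
          rw [Finset.sum_add_distrib, ← Finset.mul_sum, h]
          simp
          ring

theorem sum_signSum_pow_four_le : ∀ {N : ℕ} (z : Fin N → ℝ),
    ∑ ε : Fin N → Bool, signSum ε z ^ 4 ≤ 2 ^ N * (3 * (∑ i, z i ^ 2) ^ 2)
  | 0, z => by simp [signSum]
  | N + 1, z => by
    rw [sum_comp_signSum_succ (fun t => t ^ 4), sum_sq_succ]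
    have h := sum_signSum_pow_four_le (Fin.tail z)
    have h2 := sum_signSum_sq (Fin.tail z)
    calc _ = ∑ ε : Fin N → Bool, (2 * signSum ε (Fin.tail z) ^ 4 +
            12 * z 0 ^ 2 * signSum ε (Fin.tail z) ^ 2 + 2 * z 0 ^ 4) :=
          Finset.sum_congr rfl fun ε _ => by ring
      _ = 2 * ∑ ε : Fin N → Bool, signSum ε (Fin.tail z) ^ 4 +
            12 * z 0 ^ 2 * (2 ^ N * ∑ i, Fin.tail z i ^ 2) + 2 ^ N * (2 * z 0 ^ 4) := by
          rw [Finset.sum_add_distrib, Finset.sum_add_distrib, ← Finset.mul_sum,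
            ← Finset.mul_sum, h2]
          simp
      _ ≤ _ := by
          have : (0:ℝ) ≤ 2 ^ N * z 0 ^ 4 := by positivity
          rw [pow_succ 2 N]
          nlinarith

/-- The exponential square moment of a Rademacher sum is at most that of a Gaussian variable with
the same variance. -/
theorem sum_exp_signSum_sq_le : ∀ {N : ℕ} (z : Fin N → ℝ) (l : ℝ), 0 ≤ l →
    2 * l * ∑ i, z i ^ 2 < 1 →
    ∑ ε : Fin N → Bool, Real.exp (l * signSum ε z ^ 2) ≤
      2 ^ N * (√(1 - 2 * l * ∑ i, z i ^ 2))⁻¹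
  | 0, z, l, _, _ => by simp [signSum]
  | N + 1, z, l, hl, hlt => by
    rw [sum_comp_signSum_succ (fun t => Real.exp (l * t ^ 2)), sum_sq_succ]
    rw [sum_sq_succ] at hlt
    set s := ∑ i, Fin.tail z i ^ 2 with hs
    have hs0 : 0 ≤ s := Finset.sum_nonneg fun i _ => sq_nonneg _
    set u := 2 * l * z 0 ^ 2 with hu
    set v := 2 * l * s with hv
    have hu0 : 0 ≤ u := by positivity
    have hv0 : 0 ≤ v := by positivity
    have huv : u + v < 1 := by rw [hu, hv]; linarith
    have hv' : 2 * (l * (1 + u)) * s = v * (1 + u) := by rw [hv]; ring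
    have hpos : 0 < 1 - v * (1 + u) := by nlinarith
    -- Averaging over the first sign, with `cosh y ≤ exp (y² / 2)`, replaces the parameter `l` by `l
    -- * (1 + u)`; hence the induction runs over all `l`.
    have ih := sum_exp_signSum_sq_le (Fin.tail z) (l * (1 + u)) (by positivity)
      (by rw [← hs, hv']; linarith)
    rw [← hs, hv'] at ih
    have hexp : Real.exp u * (1 - u) ≤ 1 := by
      have h := Real.add_one_le_exp (-u)
      have h2 : Real.exp u * Real.exp (-u) = 1 := by rw [← Real.exp_add]; simp
      have h3 := Real.exp_pos u
      nlinarith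
    have key : Real.exp u * (1 - u - v) ≤ 1 - v * (1 + u) := by
      have h1u : 0 < 1 - u := by linarith
      have h : Real.exp u ≤ (1 - u)⁻¹ := by
        rw [← one_div, le_div_iff₀ h1u]; exact hexp
      calc Real.exp u * (1 - u - v) ≤ (1 - u)⁻¹ * (1 - u - v) :=
            mul_le_mul_of_nonneg_right h (by linarith)
        _ ≤ 1 - v * (1 + u) := by
            rw [inv_mul_le_iff₀ h1u]
            nlinarith [mul_nonneg hv0 (sq_nonneg u)]
    have hsqrt : Real.exp (u / 2) * (√(1 - v * (1 + u)))⁻¹ ≤ (√(1 - u - v))⁻¹ := by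
      have h1 : 0 < √(1 - u - v) := Real.sqrt_pos.2 (by linarith)
      have h2 : 0 < √(1 - v * (1 + u)) := Real.sqrt_pos.2 hpos
      rw [← div_eq_mul_inv, ← one_div, div_le_div_iff₀ h2 h1, one_mul]
      rw [Real.exp_half, ← Real.sqrt_mul (Real.exp_pos u).le]
      exact Real.sqrt_le_sqrt key
    have hstep : ∀ ε : Fin N → Bool,
        Real.exp (l * (signSum ε (Fin.tail z) + z 0) ^ 2) +
          Real.exp (l * (signSum ε (Fin.tail z) - z 0) ^ 2) ≤
        2 * Real.exp (u / 2) * Real.exp (l * (1 + u) * signSum ε (Fin.tail z) ^ 2) := by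
      intro ε
      set X := signSum ε (Fin.tail z)
      have hc := Real.cosh_le_exp_half_sq (2 * l * X * z 0)
      rw [Real.cosh_eq] at hc
      have e1 : Real.exp (l * (X + z 0) ^ 2) =
          Real.exp (l * X ^ 2 + u / 2) * Real.exp (2 * l * X * z 0) := by
        rw [← Real.exp_add]; congr 1; rw [hu]; ring
      have e2 : Real.exp (l * (X - z 0) ^ 2) =
          Real.exp (l * X ^ 2 + u / 2) * Real.exp (-(2 * l * X * z 0)) := by
        rw [← Real.exp_add]; congr 1; rw [hu]; ring
      have e3 : Real.exp (u / 2) * Real.exp (l * (1 + u) * X ^ 2) =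
          Real.exp (l * X ^ 2 + u / 2) * Real.exp ((2 * l * X * z 0) ^ 2 / 2) := by
        rw [← Real.exp_add, ← Real.exp_add]; congr 1; rw [hu]; ring
      rw [mul_assoc, e1, e2, e3]
      have := Real.exp_pos (l * X ^ 2 + u / 2)
      nlinarith
    calc _ ≤ ∑ ε : Fin N → Bool,
          2 * Real.exp (u / 2) * Real.exp (l * (1 + u) * signSum ε (Fin.tail z) ^ 2) :=
          Finset.sum_le_sum fun ε _ => hstep ε
      _ ≤ 2 * Real.exp (u / 2) * (2 ^ N * (√(1 - v * (1 + u)))⁻¹) := by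
          rw [← Finset.mul_sum]
          exact mul_le_mul_of_nonneg_left ih (by positivity)
      _ = 2 ^ (N + 1) * (Real.exp (u / 2) * (√(1 - v * (1 + u)))⁻¹) := by ring
      _ ≤ 2 ^ (N + 1) * (√(1 - u - v))⁻¹ := mul_le_mul_of_nonneg_left hsqrt (by positivity)
      _ = _ := by rw [hu, hv]; congr 3; ring

/-- Follows from `1 + u + u²/2 ≤ exp u` and `(1 + u + u²/2)(1 - u + u²/2) = 1 + u⁴/4 ≥ 1`. -/
theorem exp_neg_le_quadratic {u : ℝ} (hu : 0 ≤ u) : Real.exp (-u) ≤ 1 - u + u ^ 2 / 2 := by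
  have h := Real.quadratic_le_exp_of_nonneg hu
  have h2 : Real.exp u * Real.exp (-u) = 1 := by rw [← Real.exp_add]; simp
  have h3 := Real.exp_pos (-u)
  have h4 : (1 + u + u ^ 2 / 2) * Real.exp (-u) ≤ 1 := by nlinarith
  have h5 : 0 < 1 + u + u ^ 2 / 2 := by positivity
  refine le_of_mul_le_mul_left (h4.trans ?_) h5
  nlinarith [sq_nonneg (u ^ 2)]

theorem sum_exp_signSum_sq_div_le {N : ℕ} (z : Fin N → ℝ) (hz : 0 < ∑ i, z i ^ 2) :
    ∑ ε : Fin N → Bool, Real.exp (signSum ε z ^ 2 / (4 * ∑ i, z i ^ 2)) ≤ 2 ^ N * 2 := by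
  set s := ∑ i, z i ^ 2 with hs
  have h12 : 2 * (4 * s)⁻¹ * s = 1 / 2 := by field_simp; norm_num
  have h := sum_exp_signSum_sq_le z (4 * s)⁻¹ (by positivity) (by rw [← hs, h12]; norm_num)
  rw [← hs, h12] at h
  have h2 : (√(1 - 1 / 2 : ℝ))⁻¹ ≤ 2 := by
    rw [inv_le_comm₀ (Real.sqrt_pos.2 (by norm_num)) (by norm_num)]
    exact Real.le_sqrt_of_sq_le (by norm_num)
  calc _ = ∑ ε : Fin N → Bool, Real.exp ((4 * s)⁻¹ * signSum ε z ^ 2) :=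
        Finset.sum_congr rfl fun ε _ => by rw [div_eq_inv_mul]
    _ ≤ _ := h
    _ ≤ _ := by gcongr

/-- Small-ball estimate from the second and fourth moments: the quadratic bound for `exp (-u)`
averages to at most `1 - 1/3 + 3/18 = 5/6`. -/
theorem sum_exp_neg_signSum_sq_div_le {N : ℕ} (z : Fin N → ℝ) (hz : 0 < ∑ i, z i ^ 2) :
    ∑ ε : Fin N → Bool, Real.exp (-(signSum ε z ^ 2 / (3 * ∑ i, z i ^ 2))) ≤
      2 ^ N * (5 / 6) := by
  have h4 := sum_signSum_pow_four_le z
  have h2 := sum_signSum_sq z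
  set s := ∑ i, z i ^ 2 with hs
  calc _ ≤ ∑ ε : Fin N → Bool, (1 - (3 * s)⁻¹ * signSum ε z ^ 2 +
          (18 * s ^ 2)⁻¹ * signSum ε z ^ 4) := by
        refine Finset.sum_le_sum fun ε _ => (exp_neg_le_quadratic (by positivity)).trans_eq ?_
        field_simp
        ring
    _ = 2 ^ N - (3 * s)⁻¹ * (2 ^ N * s) +
          (18 * s ^ 2)⁻¹ * ∑ ε : Fin N → Bool, signSum ε z ^ 4 := by
        rw [Finset.sum_add_distrib, Finset.sum_sub_distrib, ← Finset.mul_sum, ← Finset.mul_sum, h2]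
        simp
    _ ≤ 2 ^ N - (3 * s)⁻¹ * (2 ^ N * s) + (18 * s ^ 2)⁻¹ * (2 ^ N * (3 * s ^ 2)) := by
        gcongr
    _ = _ := by field_simp; norm_num

/-! ### Random sign matrices. -/

/-- The image of `z` under the sign matrix with rows `A k`. -/
def signMap {n N : ℕ} (A : Fin n → Fin N → Bool) :
    (Fin N → ℝ) →ₗ[ℝ] EuclideanSpace ℝ (Fin n) where
  toFun z := WithLp.toLp 2 fun k => signSum (A k) z
  map_add' x y := by
    ext k
    simp [signSum, mul_add, Finset.sum_add_distrib]
  map_smul' c x := by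
    ext k
    simp only [signSum, Pi.smul_apply, smul_eq_mul, RingHom.id_apply, PiLp.smul_apply,
      Finset.mul_sum]
    exact Finset.sum_congr rfl fun i _ => by ring

theorem norm_signMap_sq {n N : ℕ} (A : Fin n → Fin N → Bool) (z : Fin N → ℝ) :
    ‖signMap A z‖ ^ 2 = ∑ k, signSum (A k) z ^ 2 := by
  simp [EuclideanSpace.norm_sq_eq, signMap]

/-- The rows are independent, so the exponential moment factors. -/
theorem sum_exp_norm_signMap {n N : ℕ} (z : Fin N → ℝ) (l : ℝ) :
    ∑ A : Fin n → Fin N → Bool, Real.exp (‖signMap A z‖ ^ 2 * l) =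
      (∑ ε : Fin N → Bool, Real.exp (signSum ε z ^ 2 * l)) ^ n := by
  rw [Fintype.sum_pow]
  refine Finset.sum_congr rfl fun A _ => ?_
  rw [← Real.exp_sum, ← Finset.sum_mul, norm_signMap_sq]

theorem sum_exp_norm_signMap_le {n N : ℕ} (z : Fin N → ℝ) (hz : 0 < ∑ i, z i ^ 2) :
    ∑ A : Fin n → Fin N → Bool, Real.exp (‖signMap A z‖ ^ 2 / (4 * ∑ i, z i ^ 2)) ≤
      (2 ^ N) ^ n * 2 ^ n := by
  simp_rw [div_eq_mul_inv]
  rw [sum_exp_norm_signMap, ← mul_pow]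
  gcongr
  simpa only [div_eq_mul_inv] using sum_exp_signSum_sq_div_le z hz

theorem sum_exp_neg_norm_signMap_le {n N : ℕ} (z : Fin N → ℝ) (hz : 0 < ∑ i, z i ^ 2) :
    ∑ A : Fin n → Fin N → Bool, Real.exp (-(‖signMap A z‖ ^ 2 / (3 * ∑ i, z i ^ 2))) ≤
      (2 ^ N) ^ n * (5 / 6) ^ n := by
  simp_rw [div_eq_mul_inv _ (3 * _ : ℝ), ← mul_neg]
  rw [sum_exp_norm_signMap, ← mul_pow]
  gcongr
  simpa only [div_eq_mul_inv _ (3 * _ : ℝ), ← mul_neg] using sum_exp_neg_signSum_sq_div_le z hz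

/-! ### Counting lattice points in `l_1` balls. -/

/-- The integer points of the `l_1` ball of radius `m` in `ℝ^N` whose coordinates are at most `N` in
absolute value. -/
noncomputable def latticeBall (N : ℕ) (m : ℝ) : Finset (Fin N → ℤ) :=
  {z ∈ Fintype.piFinset fun _ : Fin N => Finset.Icc (-N : ℤ) N | ∑ i, |(z i : ℝ)| ≤ m}

/-- The box serves only to make the set finite; for radius at most `N` it imposes nothing. -/
theorem mem_latticeBall {N : ℕ} {m : ℝ} (hm : m ≤ N) {z : Fin N → ℤ} :
    z ∈ latticeBall N m ↔ ∑ i, |(z i : ℝ)| ≤ m := by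
  rw [latticeBall, Finset.mem_filter, and_iff_right_iff_imp]
  intro h
  rw [Fintype.mem_piFinset]
  intro i
  have h1 : |(z i : ℝ)| ≤ N :=
    (Finset.single_le_sum (f := fun i => |(z i : ℝ)|) (fun _ _ => abs_nonneg _)
      (Finset.mem_univ i)).trans (h.trans hm)
  rw [Finset.mem_Icc, ← abs_le]
  exact_mod_cast h1

theorem sum_Icc_pow_natAbs_le (N : ℕ) {t : ℝ} (ht : 0 ≤ t) (ht2 : t ≤ 1 / 2) :
    ∑ j ∈ Finset.Icc (-N : ℤ) N, t ^ j.natAbs ≤ 1 + 4 * t := by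
  -- The correction `-4 t^(M+1)` lets the induction close; its step is exactly `t ≤ 1/2`.
  have h : ∀ M : ℕ, ∑ j ∈ Finset.Icc (-M : ℤ) M, t ^ j.natAbs ≤ 1 + 4 * t - 4 * t ^ (M + 1) := by
    intro M
    induction M with
    | zero => simp
    | succ M ih =>
      have e : Finset.Icc (-(M + 1 : ℕ) : ℤ) (M + 1 : ℕ) =
          insert (-(M + 1 : ℕ) : ℤ) (insert ((M + 1 : ℕ) : ℤ) (Finset.Icc (-M : ℤ) M)) := by
        ext j
        simp only [Finset.mem_Icc, Finset.mem_insert]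
        push_cast
        omega
      rw [e, Finset.sum_insert (by simp; omega), Finset.sum_insert (by simp)]
      have hp : 0 ≤ t ^ (M + 1) := by positivity
      have hp2 : t ^ (M + 1 + 1) = t ^ (M + 1) * t := pow_succ _ _
      rw [Int.natAbs_neg, Int.natAbs_natCast, hp2]
      nlinarith
  refine (h N).trans ?_
  have : 0 ≤ t ^ (N + 1) := by positivity
  linarith

/-- Chernoff's method: weight each point by `t` to the power of its `l_1`-norm, extend the sum to
the whole box, and factor it over coordinates. -/
theorem card_latticeBall_mul_rpow_le {N : ℕ} {m t : ℝ} (ht : 0 < t) (ht2 : t ≤ 1 / 2) :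
    (latticeBall N m).card * t ^ m ≤ Real.exp (4 * t * N) := by
  calc (latticeBall N m).card * t ^ m = ∑ z ∈ latticeBall N m, t ^ m := by simp
    _ ≤ ∑ z ∈ latticeBall N m, ∏ i, t ^ (z i).natAbs := by
        refine Finset.sum_le_sum fun z hz => ?_
        rw [Finset.prod_pow_eq_pow_sum, ← Real.rpow_natCast]
        refine Real.rpow_le_rpow_of_exponent_ge ht (by linarith) ?_
        have := (Finset.mem_filter.1 hz).2
        push_cast [Nat.cast_natAbs]
        exact this
    _ ≤ ∑ z ∈ Fintype.piFinset fun _ : Fin N => Finset.Icc (-N : ℤ) N,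
          ∏ i, t ^ (z i).natAbs :=
        Finset.sum_le_sum_of_subset_of_nonneg (Finset.filter_subset _ _)
          fun _ _ _ => Finset.prod_nonneg fun _ _ => by positivity
    _ = (∑ j ∈ Finset.Icc (-N : ℤ) N, t ^ j.natAbs) ^ N := by
        rw [← Finset.prod_univ_sum (fun _ : Fin N => Finset.Icc (-N : ℤ) N)
          fun _ j => t ^ j.natAbs]
        simp
    _ ≤ (Real.exp (4 * t)) ^ N := by
        refine pow_le_pow_left₀ (Finset.sum_nonneg fun _ _ => by positivity) ?_ _
        refine (sum_Icc_pow_natAbs_le N ht.le ht2).trans ?_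
        linarith [Real.add_one_le_exp (4 * t)]
    _ = _ := by rw [← Real.exp_nat_mul]; congr 1; ring

/-- The entropy weight `m^{1-θ} N^θ`. -/
noncomputable def entropyWeight (θ : ℝ) (N : ℕ) (m : ℝ) : ℝ := m ^ (1 - θ) * (N : ℝ) ^ θ

theorem entropyWeight_nonneg {θ m : ℝ} {N : ℕ} (hm : 0 ≤ m) : 0 ≤ entropyWeight θ N m := by
  unfold entropyWeight; positivity

theorem entropyWeight_mono {θ m m' : ℝ} {N : ℕ} (hθ : θ ≤ 1) (hm : 0 ≤ m) (h : m ≤ m') :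
    entropyWeight θ N m ≤ entropyWeight θ N m' := by
  unfold entropyWeight
  gcongr

theorem le_entropyWeight {θ m : ℝ} {N : ℕ} (hθ : 0 ≤ θ) (hm : 0 < m) (h : m ≤ N) :
    m ≤ entropyWeight θ N m := by
  calc m = m ^ (1 - θ) * m ^ θ := by rw [← Real.rpow_add hm]; simp
    _ ≤ _ := by unfold entropyWeight; gcongr

theorem entropyWeight_eq {θ m : ℝ} {N : ℕ} (hm : 0 < m) :
    entropyWeight θ N m = m * (N / m) ^ θ := by
  unfold entropyWeight
  rw [Real.div_rpow (by positivity) hm.le, Real.rpow_sub hm, Real.rpow_one]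
  ring

/-- Take `t = m / (2N)` in the Chernoff bound and trade `log (N / m)` for `(N / m)^θ / θ`. -/
theorem card_latticeBall_le {θ : ℝ} (hθ : 0 < θ) {N : ℕ} {m : ℝ} (hm : 0 < m) (hmN : m ≤ N) :
    ((latticeBall N m).card : ℝ) ≤ Real.exp ((3 + 1 / θ) * entropyWeight θ N m) := by
  have hN : (0 : ℝ) < N := hm.trans_le hmN
  set t := m / (2 * N) with ht
  have ht0 : 0 < t := by positivity
  have h1 := card_latticeBall_mul_rpow_le (N := N) (m := m) ht0 (by
    rw [ht, div_le_iff₀ (by positivity)]; linarith)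
  have h2 : 4 * t * N = 2 * m := by rw [ht]; field_simp; ring
  rw [h2, ← le_div_iff₀ (by positivity), Real.rpow_def_of_pos ht0, ← Real.exp_sub] at h1
  refine h1.trans (Real.exp_le_exp.2 ?_)
  have hu1 : 1 ≤ N / m := (one_le_div hm).2 hmN
  have hlog : -Real.log t = Real.log 2 + Real.log (N / m) := by
    rw [← Real.log_inv, ← Real.log_mul (by norm_num) (by positivity), ht]
    congr 1
    field_simp
  have hl := Real.log_le_rpow_div (zero_le_one.trans hu1) hθ
  have hr := Real.one_le_rpow hu1 hθ.le
  have hl2 : Real.log 2 ≤ 1 := by linarith [Real.log_two_lt_d9]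
  rw [entropyWeight_eq hm]
  calc 2 * m - Real.log t * m = m * (2 + Real.log 2 + Real.log (N / m)) := by
        rw [add_assoc, ← hlog]; ring
    _ ≤ m * (3 * (N / m) ^ θ + (N / m) ^ θ / θ) := by
        gcongr; linarith
    _ = _ := by ring

theorem sum_sq_intCast_pos {N : ℕ} {z : Fin N → ℤ} (hz : z ≠ 0) : 0 < ∑ i, (z i : ℝ) ^ 2 := by
  obtain ⟨i, hi⟩ := Function.ne_iff.1 hz
  refine Finset.sum_pos' (fun _ _ => sq_nonneg _) ⟨i, Finset.mem_univ i, ?_⟩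
  have : (z i : ℝ) ≠ 0 := by exact_mod_cast hi
  positivity

theorem one_le_sum_abs_intCast {N : ℕ} {z : Fin N → ℤ} (hz : z ≠ 0) :
    1 ≤ ∑ i, |(z i : ℝ)| := by
  obtain ⟨i, hi⟩ := Function.ne_iff.1 hz
  refine le_trans ?_ (Finset.single_le_sum (f := fun i => |(z i : ℝ)|) (fun _ _ => abs_nonneg _)
    (Finset.mem_univ i))
  have : 1 ≤ |z i| := Int.one_le_abs hi
  exact_mod_cast this

theorem sum_Icc_one_third_pow_le (N : ℕ) : ∑ k ∈ Finset.Icc 1 N, (1 / 3 : ℝ) ^ k ≤ 1 / 2 := by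
  have h : ∑ k ∈ Finset.Icc 1 N, (1 / 3 : ℝ) ^ k = 1 / 2 - (1 / 3) ^ N / 2 := by
    induction N with
    | zero => simp
    | succ N ih =>
      rw [Finset.sum_Icc_succ_top (by omega), ih]
      ring
  rw [h]
  have : (0 : ℝ) ≤ (1 / 3) ^ N := by positivity
  linarith

/-- Group by `l_1`-norm `k`: the count costs `exp ((3 + 1/θ) W)`, which leaves `exp (-2W) ≤ exp
(-2k) ≤ 3^{-k}`. -/
theorem sum_exp_neg_entropyWeight_le {θ : ℝ} (hθ : 0 < θ) (N : ℕ) :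
    ∑ z ∈ (latticeBall N N).erase 0,
      Real.exp (-((5 + 1 / θ) * entropyWeight θ N (∑ i, |(z i : ℝ)|))) ≤ 1 / 2 := by
  have hcast : ∀ z : Fin N → ℤ, ((∑ i, (z i).natAbs : ℕ) : ℝ) = ∑ i, |(z i : ℝ)| := by
    intro z
    push_cast [Nat.cast_natAbs]
    rfl
  have hmaps : ∀ z ∈ (latticeBall N N).erase 0, ∑ i, (z i).natAbs ∈ Finset.Icc 1 N := by
    intro z hz
    rw [Finset.mem_erase] at hz
    have h1 := one_le_sum_abs_intCast hz.1
    have h2 := (mem_latticeBall le_rfl).1 hz.2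
    rw [← hcast] at h1 h2
    rw [Finset.mem_Icc]
    exact ⟨by exact_mod_cast h1, by exact_mod_cast h2⟩
  rw [← Finset.sum_fiberwise_of_maps_to hmaps]
  refine le_trans (Finset.sum_le_sum fun k hk => ?_) (sum_Icc_one_third_pow_le N)
  rw [Finset.mem_Icc] at hk
  have hk0 : (0 : ℝ) < k := by exact_mod_cast hk.1
  have hkN : (k : ℝ) ≤ N := by exact_mod_cast hk.2
  set W := entropyWeight θ N k with hW
  have hkW : (k : ℝ) ≤ W := le_entropyWeight hθ.le hk0 hkN
  calc _ = ∑ z ∈ (latticeBall N N).erase 0 with ∑ i, (z i).natAbs = k,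
          Real.exp (-((5 + 1 / θ) * W)) := by
        refine Finset.sum_congr rfl fun z hz => ?_
        rw [hW, ← (Finset.mem_filter.1 hz).2, hcast]
    _ ≤ (latticeBall N k).card * Real.exp (-((5 + 1 / θ) * W)) := by
        rw [Finset.sum_const, nsmul_eq_mul]
        gcongr
        intro z hz
        rw [mem_latticeBall hkN, ← hcast, (Finset.mem_filter.1 hz).2]
    _ ≤ Real.exp ((3 + 1 / θ) * W) * Real.exp (-((5 + 1 / θ) * W)) := by
        gcongr
        exact card_latticeBall_le hθ hk0 hkN
    _ = Real.exp (-(2 * W)) := by rw [← Real.exp_add]; congr 1; ring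
    _ ≤ Real.exp (k * (-2)) := Real.exp_le_exp.2 (by linarith)
    _ ≤ (1 / 3) ^ k := by
        rw [Real.exp_nat_mul]
        refine pow_le_pow_left₀ (Real.exp_pos _).le ?_ _
        rw [Real.exp_neg, one_div]
        refine inv_anti₀ (by norm_num) ?_
        linarith [Real.add_one_le_exp (2 : ℝ)]

/-! ### Existence of a good sign matrix. -/

/-- A sign matrix that is bounded on `{0, ±1}`-vectors with an entropy correction and bounded below
on sparse integer vectors. -/
theorem exists_signMap_bounds {θ : ℝ} (hθ : 0 < θ) (hθ1 : θ < 1) :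
    ∃ c C : ℝ, 0 < c ∧ 0 < C ∧ ∀ n N : ℕ, 0 < n → n ≤ N → ∃ A : Fin n → Fin N → Bool,
      (∀ z : Fin N → ℤ, (∀ i, |z i| ≤ 1) →
        ‖signMap A fun i => (z i : ℝ)‖ ^ 2 ≤
          C * (n + entropyWeight θ N (∑ i, |(z i : ℝ)|)) * ∑ i, |(z i : ℝ)|) ∧
      (∀ z : Fin N → ℤ, entropyWeight θ N (∑ i, |(z i : ℝ)|) ≤ c * n →
        n * ∑ i, (z i : ℝ) ^ 2 ≤ C * ‖signMap A fun i => (z i : ℝ)‖ ^ 2) := by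
  set K : ℝ := 3 + 1 / θ with hK
  have hK3 : 3 ≤ K := by
    have : 0 < 1 / θ := by positivity
    linarith
  -- With `K c = 1/24`, the union bound for sparse vectors has exponent `n/24 - n/6 + n/24 = -n/12`.
  -- In the second constant, 4 comes from the exponential moment and `K + 2 = 5 + 1/θ` from the
  -- weight that makes the sum over lattice points converge.
  refine ⟨1 / (24 * K), 4 * (K + 2), by positivity, by positivity, fun n N hn hnN => ?_⟩
  have hn0 : (0 : ℝ) < n := by exact_mod_cast hn
  have hnN' : (n : ℝ) ≤ N := by exact_mod_cast hnN
  have hN0 : (0 : ℝ) < N := hn0.trans_le hnN'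
  set c : ℝ := 1 / (24 * K) with hc
  have hc0 : 0 < c := by positivity
  have hc12 : c ≤ 1 / 12 := by
    rw [hc, div_le_div_iff₀ (by positivity) (by norm_num)]; linarith
  have hcK : K * c = 1 / 24 := by rw [hc]; field_simp
  have h1θ : 0 < 1 - θ := by linarith
  -- `m₀` is the radius whose entropy weight is exactly `c * n`.
  set m₀ : ℝ := (c * n / (N : ℝ) ^ θ) ^ (1 / (1 - θ)) with hm₀
  have hm₀0 : 0 < m₀ := by positivity
  have hpow : m₀ ^ (1 - θ) = c * n / (N : ℝ) ^ θ := by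
    rw [hm₀, ← Real.rpow_mul (by positivity), one_div_mul_cancel h1θ.ne', Real.rpow_one]
  have hWm₀ : entropyWeight θ N m₀ = c * n := by
    unfold entropyWeight
    rw [hpow]
    field_simp
  have hle : ∀ m : ℝ, 0 ≤ m → entropyWeight θ N m ≤ c * n → m ≤ m₀ := by
    intro m hm h
    rw [← Real.rpow_le_rpow_iff hm hm₀0.le h1θ, hpow, le_div_iff₀ (by positivity)]
    exact h
  have hm₀N : m₀ ≤ N := by
    rw [← Real.rpow_le_rpow_iff hm₀0.le hN0.le h1θ, hpow, div_le_iff₀ (by positivity),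
      ← Real.rpow_add hN0, sub_add_cancel, Real.rpow_one]
    nlinarith
  -- `F` penalises large images and `G` small images of sparse vectors. Each averages to at most
  -- 1/2, so some matrix has `F + G ≤ 1`, and then every single summand is at most 1.
  let F : (Fin n → Fin N → Bool) → ℝ := fun A =>
    ∑ z ∈ (latticeBall N N).erase 0,
      Real.exp (‖signMap A fun i => (z i : ℝ)‖ ^ 2 / (4 * ∑ i, (z i : ℝ) ^ 2)) *
        ((2 ^ n)⁻¹ * Real.exp (-((5 + 1 / θ) * entropyWeight θ N (∑ i, |(z i : ℝ)|))))
  let G : (Fin n → Fin N → Bool) → ℝ := fun A =>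
    ∑ z ∈ (latticeBall N m₀).erase 0,
      Real.exp (-(‖signMap A fun i => (z i : ℝ)‖ ^ 2 / (3 * ∑ i, (z i : ℝ) ^ 2))) *
        Real.exp (n / 24)
  have hF : ∑ A, F A ≤ (2 ^ N) ^ n * (1 / 2) := by
    rw [Finset.sum_comm]
    simp_rw [← Finset.sum_mul]
    calc _ ≤ ∑ z ∈ (latticeBall N N).erase 0, ((2 ^ N) ^ n * 2 ^ n) *
          ((2 ^ n)⁻¹ * Real.exp (-((5 + 1 / θ) * entropyWeight θ N (∑ i, |(z i : ℝ)|)))) := by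
          refine Finset.sum_le_sum fun z hz => ?_
          gcongr
          exact sum_exp_norm_signMap_le _ (sum_sq_intCast_pos (Finset.mem_erase.1 hz).1)
      _ = (2 ^ N) ^ n * ∑ z ∈ (latticeBall N N).erase 0,
            Real.exp (-((5 + 1 / θ) * entropyWeight θ N (∑ i, |(z i : ℝ)|))) := by
          rw [Finset.mul_sum]
          refine Finset.sum_congr rfl fun z _ => ?_
          rw [mul_assoc, mul_inv_cancel_left₀ (by positivity)]
      _ ≤ _ := by gcongr; exact sum_exp_neg_entropyWeight_le hθ N
  have hG : ∑ A, G A ≤ (2 ^ N) ^ n * (1 / 2) := by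
    rw [Finset.sum_comm]
    simp_rw [← Finset.sum_mul]
    rcases ((latticeBall N m₀).erase 0).eq_empty_or_nonempty with he | ⟨z, hz⟩
    · rw [he]; simp
    rw [Finset.mem_erase, mem_latticeBall hm₀N] at hz
    -- A nonzero lattice point forces `1 ≤ m₀ ≤ c n ≤ n / 12`; this is what makes `exp (-n / 12) ≤
    -- 1/2`.
    have hn12 : (12 : ℝ) ≤ n := by
      have h1 : 1 ≤ m₀ := (one_le_sum_abs_intCast hz.1).trans hz.2
      have h2 := h1.trans (le_entropyWeight hθ.le hm₀0 hm₀N)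
      rw [hWm₀] at h2
      nlinarith
    calc _ ≤ (∑ z ∈ (latticeBall N m₀).erase 0, (2 ^ N) ^ n * (5 / 6) ^ n) *
            Real.exp (n / 24) := by
          gcongr with z hz
          exact sum_exp_neg_norm_signMap_le _ (sum_sq_intCast_pos (Finset.mem_erase.1 hz).1)
      _ ≤ ((latticeBall N m₀).card * ((2 ^ N) ^ n * Real.exp (n * (-(1 / 6))))) *
            Real.exp (n / 24) := by
          rw [Finset.sum_const, nsmul_eq_mul, Real.exp_nat_mul]
          gcongr
          · exact Finset.erase_subset _ _
          · linarith [Real.add_one_le_exp (-(1 / 6) : ℝ)]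
      _ ≤ (Real.exp (K * (c * n)) * ((2 ^ N) ^ n * Real.exp (n * (-(1 / 6))))) *
            Real.exp (n / 24) := by
          gcongr
          rw [← hWm₀]
          exact card_latticeBall_le hθ hm₀0 hm₀N
      _ = (2 ^ N) ^ n * Real.exp (-(n / 12)) := by
          have : Real.exp (-(n / 12)) =
              Real.exp (K * (c * n)) * Real.exp (n * (-(1 / 6))) * Real.exp (n / 24) := by
            rw [← Real.exp_add, ← Real.exp_add, ← mul_assoc, hcK]
            congr 1; ring
          rw [this]; ring
      _ ≤ (2 ^ N) ^ n * (1 / 2) := by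
          gcongr
          rw [Real.exp_neg, one_div]
          refine inv_anti₀ (by norm_num) ?_
          linarith [Real.add_one_le_exp (n / 12 : ℝ)]
  obtain ⟨A, -, hA⟩ : ∃ A ∈ (Finset.univ : Finset (Fin n → Fin N → Bool)), F A + G A ≤ 1 := by
    refine Finset.exists_le_of_sum_le Finset.univ_nonempty ?_
    rw [Finset.sum_add_distrib]
    simp
    linarith
  have hF0 : 0 ≤ F A := Finset.sum_nonneg fun _ _ => by positivity
  have hG0 : 0 ≤ G A := Finset.sum_nonneg fun _ _ => by positivity
  refine ⟨A, fun z hz => ?_, fun z hz => ?_⟩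
  · rcases eq_or_ne z 0 with rfl | hz0
    · have : (fun i : Fin N => (((0 : Fin N → ℤ) i : ℤ) : ℝ)) = 0 := by ext; simp
      rw [this]; simp
    have hs := sum_sq_intCast_pos hz0
    have hzabs : ∀ i, |(z i : ℝ)| ≤ 1 := fun i => by exact_mod_cast hz i
    have hmem : z ∈ (latticeBall N N).erase 0 := by
      rw [Finset.mem_erase, mem_latticeBall le_rfl]
      refine ⟨hz0, (Finset.sum_le_sum fun i _ => hzabs i).trans (by simp)⟩
    set W := entropyWeight θ N (∑ i, |(z i : ℝ)|) with hW
    have hW0 : 0 ≤ W := entropyWeight_nonneg (Finset.sum_nonneg fun _ _ => abs_nonneg _)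
    have hterm := (Finset.single_le_sum (fun _ _ => by positivity) hmem).trans
      (show F A ≤ 1 by linarith)
    simp only [← hW] at hterm
    have h2 : (2 : ℝ) ^ n ≤ Real.exp n := by
      rw [← mul_one (n : ℝ), Real.exp_nat_mul]
      gcongr
      linarith [Real.add_one_le_exp (1 : ℝ)]
    rw [← div_eq_inv_mul, ← mul_div_assoc, div_le_one (by positivity)] at hterm
    have h3 := hterm.trans h2
    rw [← Real.exp_add, Real.exp_le_exp] at h3
    have h4 : ‖signMap A fun i => (z i : ℝ)‖ ^ 2 / (4 * ∑ i, (z i : ℝ) ^ 2) ≤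
        (K + 2) * (n + W) := by
      have : 5 + 1 / θ = K + 2 := by rw [hK]; ring
      rw [this] at h3
      nlinarith
    rw [div_le_iff₀ (by positivity)] at h4
    have h5 : ∑ i, (z i : ℝ) ^ 2 ≤ ∑ i, |(z i : ℝ)| := by
      refine Finset.sum_le_sum fun i _ => ?_
      rw [← sq_abs]
      nlinarith [hzabs i, abs_nonneg (z i : ℝ)]
    calc _ ≤ _ := h4
      _ = 4 * (K + 2) * (n + W) * ∑ i, (z i : ℝ) ^ 2 := by ring
      _ ≤ _ := by gcongr
  · rcases eq_or_ne z 0 with rfl | hz0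
    · simp; positivity
    have hs := sum_sq_intCast_pos hz0
    have hmem : z ∈ (latticeBall N m₀).erase 0 := by
      rw [Finset.mem_erase, mem_latticeBall hm₀N]
      exact ⟨hz0, hle _ (Finset.sum_nonneg fun _ _ => abs_nonneg _) hz⟩
    have hterm := (Finset.single_le_sum (fun _ _ => by positivity) hmem).trans
      (show G A ≤ 1 by linarith)
    rw [← Real.exp_add, Real.exp_le_one_iff] at hterm
    have h4 : (n : ℝ) / 24 ≤ ‖signMap A fun i => (z i : ℝ)‖ ^ 2 / (3 * ∑ i, (z i : ℝ) ^ 2) := by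
      linarith
    rw [le_div_iff₀ (by positivity)] at h4
    nlinarith [sq_nonneg ‖signMap A fun i => (z i : ℝ)‖]

/-! ### Rounding to dyadic grids. -/

/-- Rounding a real number to an integer, towards zero. -/
noncomputable def truncInt (u : ℝ) : ℤ := if 0 ≤ u then ⌊u⌋ else -⌊-u⌋

theorem abs_truncInt_le (u : ℝ) : |(truncInt u : ℝ)| ≤ |u| := by
  unfold truncInt
  split_ifs with h
  · rw [abs_of_nonneg (by exact_mod_cast Int.floor_nonneg.2 h), abs_of_nonneg h]
    exact Int.floor_le u
  · have h' : 0 ≤ -u := by linarith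
    push_cast
    rw [abs_neg, abs_of_nonneg (by exact_mod_cast Int.floor_nonneg.2 h'),
      abs_of_nonpos (by linarith)]
    exact Int.floor_le (-u)

theorem truncInt_eq_zero {u : ℝ} (hu : |u| < 1) : truncInt u = 0 := by
  have h := (abs_truncInt_le u).trans_lt hu
  rw [← Int.abs_lt_one_iff]
  exact_mod_cast h

theorem abs_sub_truncInt_le_one (u : ℝ) : |u - truncInt u| ≤ 1 := by
  unfold truncInt
  split_ifs with h
  · rw [abs_le]
    constructor <;> linarith [Int.floor_le u, Int.lt_floor_add_one u]
  · push_cast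
    rw [abs_le]
    constructor <;> linarith [Int.floor_le (-u), Int.lt_floor_add_one (-u)]

theorem abs_sub_truncInt_le_abs (u : ℝ) : |u - truncInt u| ≤ |u| := by
  rcases lt_or_ge |u| 1 with h | h
  · simp [truncInt_eq_zero h]
  · exact (abs_sub_truncInt_le_one u).trans h

/-- Rounding towards zero kills `|u| < 1`, and otherwise `|u| ≤ |u|^p`; this turns `l_p` bounds into
`l_1` bounds on integer vectors. -/
theorem abs_truncInt_le_rpow {p : ℝ} (hp : 1 ≤ p) (u : ℝ) : |(truncInt u : ℝ)| ≤ |u| ^ p := by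
  rcases lt_or_ge |u| 1 with h | h
  · simp [truncInt_eq_zero h]; positivity
  · exact (abs_truncInt_le u).trans (Real.self_le_rpow_of_one_le h hp)

theorem floor_two_mul_sub_mem {u : ℝ} : 0 ≤ ⌊2 * u⌋ - 2 * ⌊u⌋ ∧ ⌊2 * u⌋ - 2 * ⌊u⌋ ≤ 1 := by
  have h1 : 2 * ⌊u⌋ ≤ ⌊2 * u⌋ := Int.le_floor.2 (by push_cast; linarith [Int.floor_le u])
  have h2 : ⌊2 * u⌋ < 2 * ⌊u⌋ + 2 :=
    Int.floor_lt.2 (by push_cast; linarith [Int.lt_floor_add_one u])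
  omega

theorem abs_truncInt_two_mul_sub_le_one (u : ℝ) : |truncInt (2 * u) - 2 * truncInt u| ≤ 1 := by
  unfold truncInt
  rw [abs_le]
  split_ifs with h h' h'
  · have := @floor_two_mul_sub_mem u; omega
  · linarith
  · linarith
  · have := @floor_two_mul_sub_mem (-u)
    rw [mul_neg] at this
    omega

theorem abs_truncInt_two_mul_sub_le_rpow {p : ℝ} (hp : 1 ≤ p) (u : ℝ) :
    |((truncInt (2 * u) - 2 * truncInt u : ℤ) : ℝ)| ≤ |2 * u| ^ p := by
  rcases lt_or_ge |2 * u| 1 with h | h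
  · have h' : |u| < 1 := by
      rw [abs_mul, abs_two] at h
      linarith [abs_nonneg u]
    simp [truncInt_eq_zero h, truncInt_eq_zero h']
    positivity
  · refine le_trans ?_ (Real.one_le_rpow h (by linarith))
    exact_mod_cast abs_truncInt_two_mul_sub_le_one u

/-- Rounding a vector towards zero on the grid of mesh `b`. -/
noncomputable def gridTrunc {N : ℕ} (b : ℝ) (x : Fin N → ℝ) : Fin N → ℝ :=
  fun i => b * truncInt (x i / b)

theorem abs_sub_gridTrunc_le {N : ℕ} {b : ℝ} (hb : 0 < b) (x : Fin N → ℝ) (i : Fin N) :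
    |x i - gridTrunc b x i| ≤ b ∧ |x i - gridTrunc b x i| ≤ |x i| := by
  have h : x i - gridTrunc b x i = b * (x i / b - truncInt (x i / b)) := by
    rw [gridTrunc, mul_sub, mul_div_cancel₀ _ hb.ne']
  rw [h, abs_mul, abs_of_pos hb]
  constructor
  · exact mul_le_of_le_one_right hb.le (abs_sub_truncInt_le_one _)
  · calc _ ≤ b * |x i / b| := 
        mul_le_mul_of_nonneg_left (abs_sub_truncInt_le_abs _) hb.le
      _ = |x i| := by rw [abs_div, abs_of_pos hb, mul_div_cancel₀ _ hb.ne']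

/-- Successive truncations differ by a layer: by `abs_truncInt_two_mul_sub_le_one` the integer
vector on the right has entries in `{0, ±1}`. -/
theorem gridTrunc_sub_gridTrunc_two_mul {N : ℕ} {b : ℝ} (x : Fin N → ℝ) :
    gridTrunc b x - gridTrunc (2 * b) x = b • fun i =>
      ((truncInt (2 * (x i / (2 * b))) - 2 * truncInt (x i / (2 * b)) : ℤ) : ℝ) := by
  ext i
  have : 2 * (x i / (2 * b)) = x i / b := by
    rw [← mul_div_assoc, mul_div_mul_left _ _ two_ne_zero]
  simp only [gridTrunc, Pi.sub_apply, Pi.smul_apply, smul_eq_mul, this]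
  push_cast
  ring

theorem sum_abs_div_rpow_le {N : ℕ} {p b : ℝ} (hb : 0 < b) {x : Fin N → ℝ}
    (hx : ∑ i, |x i| ^ p ≤ 1) : ∑ i, |x i / b| ^ p ≤ b ^ (-p) := by
  calc ∑ i, |x i / b| ^ p = (∑ i, |x i| ^ p) * b ^ (-p) := by
        rw [Finset.sum_mul]
        refine Finset.sum_congr rfl fun i _ => ?_
        rw [abs_div, abs_of_pos hb, Real.div_rpow (abs_nonneg _) hb.le, Real.rpow_neg hb.le]
        rfl
    _ ≤ _ := mul_le_of_le_one_left (by positivity) hx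

/-! ### Images of the dyadic layers. -/

/-- A quantity that decays in both directions of `u` is dominated by the increments of a bounded
function of `v = u ^ β` under `v ↦ r * v`. -/
theorem le_increment_of_le_of_mul_le_one {S v r : ℝ} (hr0 : 0 < r) (hr : r < 1) (hv : 0 < v)
    (h1 : S ≤ v) (h2 : S * v ≤ 1) :
    S ≤ 4 / (1 - r) * (v / (1 + v) - r * v / (1 + r * v)) := by
  have h : 4 / (1 - r) * (v / (1 + v) - r * v / (1 + r * v)) =
      4 * v / ((1 + v) * (1 + r * v)) := by
    have : 1 - r ≠ 0 := by linarith
    field_simp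
    ring
  rw [h, le_div_iff₀ (by positivity)]
  rcases le_or_gt S 0 with hS | hS
  · have : 0 < (1 + v) * (1 + r * v) := by positivity
    nlinarith
  have h3 : 1 + r * v ≤ 1 + v := by nlinarith
  calc S * ((1 + v) * (1 + r * v)) ≤ S * ((1 + v) * (1 + v)) := by gcongr
    _ = S + 2 * (S * v) + (S * v) * v := by ring
    -- `S (1 - v)² ≥ 0` gives `2 S v ≤ S + S v²`, and `S + S v² ≤ 2 v`.
    _ ≤ 4 * v := by
      nlinarith [mul_nonneg hS.le (sq_nonneg (1 - v)), mul_le_mul_of_nonneg_right h2 hv.le]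

/-- The bound for one dyadic layer. -/
theorem norm_layer_le {p θ C : ℝ} (hp : 1 < p) (hp2 : p < 2) (hθ : θ = 1 - 1 / p) (hC : 0 ≤ C)
    {n N : ℕ} (hN : 0 < N) {E : Type*} [NormedAddCommGroup E] [NormedSpace ℝ E]
    (Λ : (Fin N → ℝ) →ₗ[ℝ] E)
    (hU : ∀ z : Fin N → ℤ, (∀ i, |z i| ≤ 1) → ‖Λ fun i => (z i : ℝ)‖ ^ 2 ≤
      C * (n + entropyWeight θ N (∑ i, |(z i : ℝ)|)) * ∑ i, |(z i : ℝ)|)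
    {b : ℝ} (hb : 0 < b) {z : Fin N → ℤ} (hz : ∀ i, |z i| ≤ 1)
    (hzb : ∑ i, |(z i : ℝ)| ≤ b ^ (-p)) :
    ∃ S : ℝ, S ≤ (b * (N : ℝ) ^ (1 / p)) ^ ((p - 1) / 2) ∧
      S * (b * (N : ℝ) ^ (1 / p)) ^ ((p - 1) / 2) ≤ 1 ∧
      ‖Λ (b • fun i => (z i : ℝ))‖ ≤ √C * (√n * b ^ (1 - p / 2) + (N : ℝ) ^ θ * S) := by
  have hN0 : (0 : ℝ) < N := by exact_mod_cast hN
  have hp0 : 0 < p := by linarith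
  have hpθ : p * θ = p - 1 := by rw [hθ]; field_simp
  have hθ0 : 0 < θ := by
    have : 0 < p * θ := by linarith
    exact pos_of_mul_pos_right this hp0.le
  have hθ1 : θ < 1 := by
    rw [hθ]
    have : 0 < 1 / p := by positivity
    linarith
  set m := ∑ i, |(z i : ℝ)| with hm
  have hm0 : 0 ≤ m := Finset.sum_nonneg fun _ _ => abs_nonneg _
  have hmN : m ≤ N := by
    refine (Finset.sum_le_sum fun i _ => show |(z i : ℝ)| ≤ 1 from ?_).trans (by simp)
    exact_mod_cast hz i
  have hUz := hU z hz
  rw [← hm] at hUz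
  set u := b * (N : ℝ) ^ (1 / p) with hu
  have hu0 : 0 < u := by positivity
  set β := (p - 1) / 2 with hβ
  have hβ0 : 0 < β := by rw [hβ]; linarith
  set Q := entropyWeight θ N m * m * b ^ 2 with hQ
  have hQ0 : 0 ≤ Q := mul_nonneg (mul_nonneg (entropyWeight_nonneg hm0) hm0) (sq_nonneg b)
  -- The entropy term is bounded through either `m ≤ N` or `m ≤ b^{-p}`; the first gives decay for
  -- small `u`, the second for large `u`.
  have hWM : ∀ M : ℝ, m ≤ M → 0 < M → Q ≤ M ^ (2 - θ) * (N : ℝ) ^ θ * b ^ 2 := by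
    intro M hmM hM
    have h1 := entropyWeight_mono (N := N) hθ1.le hm0 hmM
    have h2 : M ^ (2 - θ) = M ^ (1 - θ) * M := by
      rw [← Real.rpow_add_one hM.ne']; congr 1; ring
    rw [h2, hQ]
    calc _ ≤ entropyWeight θ N M * M * b ^ 2 := by
          have := entropyWeight_nonneg (θ := θ) (N := N) hM.le
          gcongr
      _ = _ := by unfold entropyWeight; ring
  have hNθ : (N : ℝ) ^ θ * (N : ℝ) ^ (1 / p) = N := by
    rw [← Real.rpow_add hN0, hθ, sub_add_cancel, Real.rpow_one]
  have hQ1 : Q ≤ ((N : ℝ) ^ θ * u) ^ 2 := by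
    refine (hWM N hmN hN0).trans_eq ?_
    rw [← Real.rpow_add hN0, sub_add_cancel, hu, mul_left_comm, hNθ, Real.rpow_two]
    ring
  have hQ2 : Q ≤ ((N : ℝ) ^ θ * u ^ (-β)) ^ 2 := by
    refine (hWM _ hzb (by positivity)).trans_eq ?_
    have e1 : (b ^ (-p)) ^ (2 - θ) * b ^ 2 = b ^ (-(p - 1)) := by
      rw [← Real.rpow_mul hb.le, ← Real.rpow_natCast b 2, ← Real.rpow_add hb]
      congr 1
      push_cast
      linear_combination hpθ
    have e2 : (u ^ (-β)) ^ 2 = b ^ (-(p - 1)) * (N : ℝ) ^ (-θ) := by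
      rw [← Real.rpow_natCast, ← Real.rpow_mul hu0.le, hu, Real.mul_rpow hb.le (by positivity),
        ← Real.rpow_mul hN0.le]
      congr 2
      · rw [hβ]; push_cast; ring
      · rw [hβ, hθ]; push_cast; field_simp
    have e3 : ((N : ℝ) ^ θ) ^ 2 * (N : ℝ) ^ (-θ) = (N : ℝ) ^ θ := by
      rw [← Real.rpow_natCast, ← Real.rpow_mul hN0.le, ← Real.rpow_add hN0]
      congr 1; push_cast; ring
    rw [mul_pow, e2, mul_right_comm, e1, mul_left_comm, e3]
  have hNpos : 0 < (N : ℝ) ^ θ := by positivity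
  have hS1 : √Q / (N : ℝ) ^ θ ≤ u := by
    rw [div_le_iff₀' hNpos]; exact Real.sqrt_le_iff.2 ⟨by positivity, hQ1⟩
  have hS2 : √Q / (N : ℝ) ^ θ ≤ u ^ (-β) := by
    rw [div_le_iff₀' hNpos]; exact Real.sqrt_le_iff.2 ⟨by positivity, hQ2⟩
  -- For `u ≤ 1` the stronger bound `u` is weakened to `u ^ β`, so that both directions decay with
  -- one exponent.
  refine ⟨√Q / (N : ℝ) ^ θ, ?_, ?_, ?_⟩
  · rcases le_or_gt u 1 with h | h
    · refine hS1.trans ?_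
      conv_lhs => rw [← Real.rpow_one u]
      exact Real.rpow_le_rpow_of_exponent_ge hu0 h (by rw [hβ]; linarith)
    · exact hS2.trans (Real.rpow_le_rpow_of_exponent_le h.le (by linarith))
  · calc _ ≤ u ^ (-β) * u ^ β := by gcongr
      _ = 1 := by rw [← Real.rpow_add hu0]; simp
  · rw [mul_div_cancel₀ _ hNpos.ne', map_smul, norm_smul, Real.norm_of_nonneg hb.le]
    have hb2 : (b ^ (1 - p / 2)) ^ 2 = b ^ (-p) * b ^ 2 := by
      rw [← Real.rpow_natCast, ← Real.rpow_natCast, ← Real.rpow_mul hb.le, ← Real.rpow_add hb]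
      congr 1; push_cast; ring
    refine abs_le_of_sq_le_sq' ?_ (by positivity) |>.2
    have hsn : √(n : ℝ) ^ 2 = n := Real.sq_sqrt (by positivity)
    have hsQ : √Q ^ 2 = Q := Real.sq_sqrt hQ0
    calc (b * ‖Λ fun i => (z i : ℝ)‖) ^ 2 = b ^ 2 * ‖Λ fun i => (z i : ℝ)‖ ^ 2 := by ring
      _ ≤ b ^ 2 * (C * (n + entropyWeight θ N m) * m) := by gcongr
      _ = C * (n * (m * b ^ 2) + Q) := by rw [hQ]; ring
      _ ≤ C * (n * (b ^ (-p) * b ^ 2) + Q) := by gcongr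
      _ = C * ((√n * b ^ (1 - p / 2)) ^ 2 + √Q ^ 2) := by rw [mul_pow, hb2, hsn, hsQ]
      _ ≤ C * (√n * b ^ (1 - p / 2) + √Q) ^ 2 := by
          gcongr
          have : 0 ≤ √n * b ^ (1 - p / 2) * √Q := by positivity
          nlinarith
      _ = _ := by rw [mul_pow, Real.sq_sqrt hC]

/-- The potential whose increments dominate the dyadic layers. -/
noncomputable def layerPotential (p θ C : ℝ) (n N : ℕ) (b : ℝ) : ℝ :=
  √C * (√n * (b ^ (1 - p / 2) / (1 - (1 / 2) ^ (1 - p / 2))) +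
    (N : ℝ) ^ θ * (4 / (1 - (1 / 2) ^ ((p - 1) / 2)) *
      ((b * (N : ℝ) ^ (1 / p)) ^ ((p - 1) / 2) /
        (1 + (b * (N : ℝ) ^ (1 / p)) ^ ((p - 1) / 2)))))

theorem half_rpow_lt_one {s : ℝ} (hs : 0 < s) : (1 / 2 : ℝ) ^ s < 1 :=
  Real.rpow_lt_one (by norm_num) (by norm_num) hs

theorem layerPotential_nonneg {p θ C b : ℝ} (hp : 1 < p) (hp2 : p < 2) {n N : ℕ} (hb : 0 < b) :
    0 ≤ layerPotential p θ C n N b := by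
  have h1 : 0 < 1 - (1 / 2 : ℝ) ^ (1 - p / 2) := by
    linarith [half_rpow_lt_one (s := 1 - p / 2) (by linarith)]
  have h2 : 0 < 1 - (1 / 2 : ℝ) ^ ((p - 1) / 2) := by
    linarith [half_rpow_lt_one (s := (p - 1) / 2) (by linarith)]
  unfold layerPotential
  positivity

/-- The entropy part stays bounded uniformly in `b`: over all scales it costs only a multiple of
`N^θ`. -/
theorem layerPotential_le {p θ C b : ℝ} (hp : 1 < p) {n N : ℕ} (hb : 0 < b) :
    layerPotential p θ C n N b ≤
      √C * (√n * (b ^ (1 - p / 2) / (1 - (1 / 2) ^ (1 - p / 2))) +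
        (N : ℝ) ^ θ * (4 / (1 - (1 / 2) ^ ((p - 1) / 2)))) := by
  have h2 : 0 < 1 - (1 / 2 : ℝ) ^ ((p - 1) / 2) := by
    linarith [half_rpow_lt_one (s := (p - 1) / 2) (by linarith)]
  unfold layerPotential
  gcongr
  refine mul_le_of_le_one_right (by positivity) ?_
  rw [div_le_one (by positivity)]
  linarith

/-- Writing the layer bound as an increment makes the sum over scales telescope, with no infinite
series. The geometric term is an exact increment; the entropy term is dominated by one. -/
theorem norm_layer_le_increment {p θ C : ℝ} (hp : 1 < p) (hp2 : p < 2) (hθ : θ = 1 - 1 / p)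
    (hC : 0 ≤ C) {n N : ℕ} (hN : 0 < N) {E : Type*} [NormedAddCommGroup E] [NormedSpace ℝ E]
    (Λ : (Fin N → ℝ) →ₗ[ℝ] E)
    (hU : ∀ z : Fin N → ℤ, (∀ i, |z i| ≤ 1) → ‖Λ fun i => (z i : ℝ)‖ ^ 2 ≤
      C * (n + entropyWeight θ N (∑ i, |(z i : ℝ)|)) * ∑ i, |(z i : ℝ)|)
    {b : ℝ} (hb : 0 < b) {z : Fin N → ℤ} (hz : ∀ i, |z i| ≤ 1)
    (hzb : ∑ i, |(z i : ℝ)| ≤ b ^ (-p)) :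
    ‖Λ (b • fun i => (z i : ℝ))‖ ≤
      layerPotential p θ C n N b - layerPotential p θ C n N (b / 2) := by
  have hN0 : (0 : ℝ) < N := by exact_mod_cast hN
  obtain ⟨S, hS1, hS2, hS⟩ := norm_layer_le hp hp2 hθ hC hN Λ hU hb hz hzb
  have hr1 := half_rpow_lt_one (s := 1 - p / 2) (by linarith)
  have hr2 := half_rpow_lt_one (s := (p - 1) / 2) (by linarith)
  have hinc := le_increment_of_le_of_mul_le_one (r := (1 / 2 : ℝ) ^ ((p - 1) / 2))
    (by positivity) hr2 (by positivity) hS1 hS2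
  refine hS.trans ?_
  have e1 : (b / 2) ^ (1 - p / 2) = (1 / 2) ^ (1 - p / 2) * b ^ (1 - p / 2) := by
    rw [← Real.mul_rpow (by norm_num) hb.le]; congr 1; ring
  have e2 : (b / 2 * (N : ℝ) ^ (1 / p)) ^ ((p - 1) / 2) =
      (1 / 2) ^ ((p - 1) / 2) * (b * (N : ℝ) ^ (1 / p)) ^ ((p - 1) / 2) := by
    rw [← Real.mul_rpow (by norm_num) (by positivity)]; congr 1; ring
  unfold layerPotential
  rw [e1, e2, ← mul_sub]
  have e3 : b ^ (1 - p / 2) = b ^ (1 - p / 2) / (1 - (1 / 2) ^ (1 - p / 2)) -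
      (1 / 2) ^ (1 - p / 2) * b ^ (1 - p / 2) / (1 - (1 / 2) ^ (1 - p / 2)) := by
    have : 1 - (1 / 2 : ℝ) ^ (1 - p / 2) ≠ 0 := by linarith
    rw [← sub_div, eq_div_iff this]
    ring
  refine mul_le_mul_of_nonneg_left ?_ (Real.sqrt_nonneg _)
  have h3 := mul_le_mul_of_nonneg_left hinc (show 0 ≤ (N : ℝ) ^ θ by positivity)
  have h4 := congrArg (√(n : ℝ) * ·) e3
  simp only [mul_sub] at h3 h4
  linarith

theorem tendsto_gridTrunc {N : ℕ} {a : ℝ} (ha : 0 < a) (x : Fin N → ℝ) :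
    Filter.Tendsto (fun J : ℕ => gridTrunc (a / 2 ^ J) x) Filter.atTop (nhds x) := by
  rw [tendsto_pi_nhds]
  intro i
  rw [tendsto_iff_dist_tendsto_zero]
  have h0 : Filter.Tendsto (fun J : ℕ => a / (2 : ℝ) ^ J) Filter.atTop (nhds 0) :=
    tendsto_const_nhds.div_atTop (tendsto_pow_atTop_atTop_of_one_lt one_lt_two)
  refine squeeze_zero (fun _ => dist_nonneg) (fun J => ?_) h0
  rw [dist_comm, Real.dist_eq]
  exact (abs_sub_gridTrunc_le (by positivity) x i).1

/-- Telescope from mesh `a` to mesh `a / 2^J`; the truncations tend to `x` and `Λ x = 0`, so only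
the layers contribute. -/
theorem norm_map_gridTrunc_le {p θ C : ℝ} (hp : 1 < p) (hp2 : p < 2) (hθ : θ = 1 - 1 / p)
    (hC : 0 ≤ C) {n N : ℕ} (hN : 0 < N) {E : Type*} [NormedAddCommGroup E] [NormedSpace ℝ E]
    (Λ : (Fin N → ℝ) →ₗ[ℝ] E)
    (hU : ∀ z : Fin N → ℤ, (∀ i, |z i| ≤ 1) → ‖Λ fun i => (z i : ℝ)‖ ^ 2 ≤
      C * (n + entropyWeight θ N (∑ i, |(z i : ℝ)|)) * ∑ i, |(z i : ℝ)|)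
    {a : ℝ} (ha : 0 < a) {x : Fin N → ℝ} (hx : ∑ i, |x i| ^ p ≤ 1) (hΛ : Λ x = 0) :
    ‖Λ (gridTrunc a x)‖ ≤ layerPotential p θ C n N (a / 2) := by
  have hstep : ∀ b : ℝ, 0 < b → ‖Λ (gridTrunc (2 * b) x)‖ ≤ ‖Λ (gridTrunc b x)‖ +
      (layerPotential p θ C n N b - layerPotential p θ C n N (b / 2)) := by
    intro b hb
    have h := norm_layer_le_increment hp hp2 hθ hC hN Λ hU hb
      (z := fun i => truncInt (2 * (x i / (2 * b))) - 2 * truncInt (x i / (2 * b)))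
      (fun i => abs_truncInt_two_mul_sub_le_one _) (by
        refine le_trans (Finset.sum_le_sum fun i _ =>
          abs_truncInt_two_mul_sub_le_rpow hp.le (x i / (2 * b))) ?_
        refine le_trans (Finset.sum_le_sum fun i _ => le_of_eq ?_) (sum_abs_div_rpow_le hb hx)
        rw [← mul_div_assoc, mul_div_mul_left _ _ two_ne_zero])
    rw [← gridTrunc_sub_gridTrunc_two_mul, map_sub] at h
    have := norm_sub_norm_le (Λ (gridTrunc (2 * b) x)) (Λ (gridTrunc b x))
    rw [norm_sub_rev] at this
    linarith
  have hind : ∀ J : ℕ, ‖Λ (gridTrunc a x)‖ ≤ ‖Λ (gridTrunc (a / 2 ^ J) x)‖ +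
      (layerPotential p θ C n N (a / 2) - layerPotential p θ C n N (a / 2 ^ (J + 1))) := by
    intro J
    induction J with
    | zero => simp
    | succ J ih =>
      have h := hstep (a / 2 ^ (J + 1)) (by positivity)
      have e1 : 2 * (a / 2 ^ (J + 1)) = a / 2 ^ J := by rw [pow_succ]; field_simp
      have e2 : a / 2 ^ (J + 1) / 2 = a / 2 ^ (J + 1 + 1) := by rw [pow_succ _ (J + 1)]; field_simp
      rw [e1, e2] at h
      linarith
  have hlim : Filter.Tendsto (fun J : ℕ => ‖Λ (gridTrunc (a / 2 ^ J) x)‖ +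
      layerPotential p θ C n N (a / 2)) Filter.atTop
      (nhds (0 + layerPotential p θ C n N (a / 2))) := by
    have hc : Continuous Λ := Λ.continuous_of_finiteDimensional
    have h := ((hc.tendsto x).comp (tendsto_gridTrunc ha x)).norm
    rw [hΛ, norm_zero] at h
    exact h.add_const _
  rw [zero_add] at hlim
  refine ge_of_tendsto' hlim fun J => (hind J).trans ?_
  have := layerPotential_nonneg (θ := θ) (C := C) (n := n) (N := N) hp hp2
    (b := a / 2 ^ (J + 1)) (by positivity)
  linarith

/-! ### The `l_2`-norm on the kernel. -/

/-- On the kernel of a linear map that is bounded on `{0, ±1}`-vectors and bounded below on sparse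
integer vectors, the `l_2`-norm is controlled by the `l_p`-norm. -/
theorem sum_sq_le_of_bounds {p θ c C : ℝ} (hp : 1 < p) (hp2 : p < 2) (hθ : θ = 1 - 1 / p)
    (hc : 0 < c) (hC : 0 < C) :
    ∃ D : ℝ, 0 < D ∧ ∀ n N : ℕ, 0 < n → n ≤ N →
      ∀ (E : Type) [NormedAddCommGroup E] [NormedSpace ℝ E] (Λ : (Fin N → ℝ) →ₗ[ℝ] E),
      (∀ z : Fin N → ℤ, (∀ i, |z i| ≤ 1) → ‖Λ fun i => (z i : ℝ)‖ ^ 2 ≤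
        C * (n + entropyWeight θ N (∑ i, |(z i : ℝ)|)) * ∑ i, |(z i : ℝ)|) →
      (∀ z : Fin N → ℤ, entropyWeight θ N (∑ i, |(z i : ℝ)|) ≤ c * n →
        n * ∑ i, (z i : ℝ) ^ 2 ≤ C * ‖Λ fun i => (z i : ℝ)‖ ^ 2) →
      ∀ x : Fin N → ℝ, ∑ i, |x i| ^ p ≤ 1 → Λ x = 0 →
        n * ∑ i, x i ^ 2 ≤ D * ((N : ℝ) ^ θ) ^ 2 := by
  have hp0 : 0 < p := by linarith
  have hpθ : p * θ = p - 1 := by rw [hθ]; field_simp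
  have hθ1 : θ ≤ 1 := by
    rw [hθ]
    have : 0 < 1 / p := by positivity
    linarith
  have hK1 : 0 < 1 - (1 / 2 : ℝ) ^ (1 - p / 2) := by
    linarith [half_rpow_lt_one (s := 1 - p / 2) (by linarith)]
  have hK2 : 0 < 1 - (1 / 2 : ℝ) ^ ((p - 1) / 2) := by
    linarith [half_rpow_lt_one (s := (p - 1) / 2) (by linarith)]
  set K₁ := 1 - (1 / 2 : ℝ) ^ (1 - p / 2)
  set K₂ := 1 - (1 / 2 : ℝ) ^ ((p - 1) / 2)
  set K₃ : ℝ := c ^ (p - 2) with hK3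
  have hK30 : 0 < K₃ := by positivity
  refine ⟨2 * (C * (√C * (√K₃ / K₁ + 4 / K₂)) ^ 2) + 2 * K₃, by positivity, ?_⟩
  intro n N hn hnN E _ _ Λ hU hL x hx hΛ
  have hn0 : (0 : ℝ) < n := by exact_mod_cast hn
  have hnN' : (n : ℝ) ≤ N := by exact_mod_cast hnN
  have hN0 : (0 : ℝ) < N := hn0.trans_le hnN'
  set P := (N : ℝ) ^ θ with hP
  have hP0 : 0 < P := by positivity
  -- Since `p (1 - θ) = 1`, the entropy weight at radius `a^{-p}` is `P / a`; this mesh makes it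
  -- equal to `c * n`.
  set a := P / (c * n) with ha
  have ha0 : 0 < a := by positivity
  -- Here `n ≤ N` enters, as `n^{p-1} ≤ N^{p-1} = P^p`. The estimate serves both the geometric part
  -- of the layers and the rounding error.
  have hna : n * a ^ (2 - p) ≤ K₃ * P ^ 2 := by
    have e1 : a ^ (2 - p) = P ^ (2 - p) * (K₃ * (n : ℝ) ^ (p - 2)) := by
      rw [ha, Real.div_rpow hP0.le (by positivity), hK3, ← Real.mul_rpow hc.le hn0.le,
        div_eq_mul_inv, ← Real.rpow_neg (by positivity)]
      congr 2; ring
    have e2 : (n : ℝ) * (n : ℝ) ^ (p - 2) = (n : ℝ) ^ (p - 1) := by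
      rw [mul_comm, ← Real.rpow_add_one hn0.ne']; congr 1; ring
    have e3 : (n : ℝ) ^ (p - 1) ≤ P ^ p := by
      rw [hP, ← Real.rpow_mul hN0.le, mul_comm θ, hpθ]
      exact Real.rpow_le_rpow hn0.le hnN' (by linarith)
    have e4 : P ^ (2 - p) * P ^ p = P ^ 2 := by
      rw [← Real.rpow_add hP0, sub_add_cancel]; norm_cast
    calc n * a ^ (2 - p) = K₃ * (P ^ (2 - p) * (n * (n : ℝ) ^ (p - 2))) := by rw [e1]; ring
      _ ≤ K₃ * (P ^ (2 - p) * P ^ p) := by rw [e2]; gcongr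
      _ = _ := by rw [e4]
  have hna2 : √n * a ^ (1 - p / 2) ≤ √K₃ * P := by
    refine abs_le_of_sq_le_sq' ?_ (by positivity) |>.2
    rw [mul_pow, mul_pow, Real.sq_sqrt hn0.le, Real.sq_sqrt hK30.le, ← Real.rpow_natCast,
      ← Real.rpow_mul ha0.le]
    have e : (1 - p / 2) * ((2 : ℕ) : ℝ) = 2 - p := by push_cast; ring
    rw [e]
    exact hna
  have hΛy : ‖Λ (gridTrunc a x)‖ ≤ √C * (√K₃ / K₁ + 4 / K₂) * P := by
    refine (norm_map_gridTrunc_le hp hp2 hθ hC.le (hn.trans_le hnN) Λ hU ha0 hx hΛ).trans ?_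
    refine (layerPotential_le hp (by positivity)).trans ?_
    calc √C * (√n * ((a / 2) ^ (1 - p / 2) / K₁) + P * (4 / K₂))
        ≤ √C * (√n * (a ^ (1 - p / 2) / K₁) + P * (4 / K₂)) := by
          gcongr
          · linarith
          · linarith
      _ = √C * ((√n * a ^ (1 - p / 2)) / K₁ + P * (4 / K₂)) := by ring
      _ ≤ √C * ((√K₃ * P) / K₁ + P * (4 / K₂)) := by gcongr
      _ = _ := by ring
  have hy : n * ∑ i, gridTrunc a x i ^ 2 ≤ C * (√C * (√K₃ / K₁ + 4 / K₂)) ^ 2 * P ^ 2 := by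
    have hW : entropyWeight θ N (∑ i, |(truncInt (x i / a) : ℝ)|) ≤ c * n := by
      calc _ ≤ entropyWeight θ N (a ^ (-p)) := by
            refine entropyWeight_mono hθ1 (Finset.sum_nonneg fun _ _ => abs_nonneg _) ?_
            exact (Finset.sum_le_sum fun i _ => abs_truncInt_le_rpow hp.le _).trans
              (sum_abs_div_rpow_le ha0 hx)
        _ = a⁻¹ * P := by
            unfold entropyWeight
            rw [← Real.rpow_mul ha0.le, ← Real.rpow_neg_one]
            congr 2
            linear_combination hpθ
        _ = c * n := by rw [ha]; field_simp
    have h := hL (fun i => truncInt (x i / a)) hW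
    have e : gridTrunc a x = a • fun i => ((truncInt (x i / a) : ℤ) : ℝ) := rfl
    have e2 : ∑ i, gridTrunc a x i ^ 2 = a ^ 2 * ∑ i, (truncInt (x i / a) : ℝ) ^ 2 := by
      rw [Finset.mul_sum]
      exact Finset.sum_congr rfl fun i _ => by rw [gridTrunc, mul_pow]
    calc n * ∑ i, gridTrunc a x i ^ 2 = a ^ 2 * (n * ∑ i, (truncInt (x i / a) : ℝ) ^ 2) := by
          rw [e2]; ring
      _ ≤ a ^ 2 * (C * ‖Λ fun i => (truncInt (x i / a) : ℝ)‖ ^ 2) := by gcongr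
      _ = C * ‖Λ (gridTrunc a x)‖ ^ 2 := by
          rw [e, map_smul, norm_smul, Real.norm_of_nonneg ha0.le]; ring
      _ ≤ C * (√C * (√K₃ / K₁ + 4 / K₂) * P) ^ 2 := by gcongr
      _ = _ := by ring
  -- Each error is at most both `a` and `|x i|`, so its square is at most `a^{2-p} |x i|^p`.
  have hxy : n * ∑ i, (x i - gridTrunc a x i) ^ 2 ≤ K₃ * P ^ 2 := by
    refine le_trans ?_ hna
    gcongr
    calc ∑ i, (x i - gridTrunc a x i) ^ 2 ≤ ∑ i, a ^ (2 - p) * |x i| ^ p := by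
          refine Finset.sum_le_sum fun i _ => ?_
          obtain ⟨h1, h2⟩ := abs_sub_gridTrunc_le ha0 x i
          rw [← sq_abs]
          set t := |x i - gridTrunc a x i|
          have ht : 0 ≤ t := abs_nonneg _
          have e : t ^ 2 = t ^ (2 - p) * t ^ p := by
            rw [← Real.rpow_add' ht (by norm_num), sub_add_cancel]; norm_cast
          rw [e]
          gcongr
      _ = a ^ (2 - p) * ∑ i, |x i| ^ p := by rw [Finset.mul_sum]
      _ ≤ _ := mul_le_of_le_one_right (by positivity) hx
  calc n * ∑ i, x i ^ 2
      ≤ n * (2 * ∑ i, gridTrunc a x i ^ 2 + 2 * ∑ i, (x i - gridTrunc a x i) ^ 2) := by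
        gcongr
        rw [Finset.mul_sum, Finset.mul_sum, ← Finset.sum_add_distrib]
        refine Finset.sum_le_sum fun i _ => ?_
        nlinarith [sq_nonneg (2 * gridTrunc a x i - x i)]
    _ ≤ _ := by linarith

/-! ### Comparison of `l_p`-norms, the balls and the rate. -/

theorem toReal_pos_of_one_le {p : ℝ≥0∞} (hp : 1 ≤ p) (hp' : p ≠ ∞) : 0 < p.toReal :=
  ENNReal.toReal_pos (zero_lt_one.trans_le hp).ne' hp'

theorem norm_toLp_rpow {N : ℕ} {p : ℝ≥0∞} (hp : 0 < p.toReal) (x : Fin N → ℝ) :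
    ‖(WithLp.toLp p x : PiLp p fun _ : Fin N => ℝ)‖ ^ p.toReal = ∑ i, |x i| ^ p.toReal := by
  rw [PiLp.norm_eq_sum hp, ← Real.rpow_mul (Finset.sum_nonneg fun _ _ => by positivity),
    one_div_mul_cancel hp.ne', Real.rpow_one]
  rfl

theorem norm_toLp_two_sq {N : ℕ} (x : Fin N → ℝ) :
    ‖(WithLp.toLp 2 x : PiLp 2 fun _ : Fin N => ℝ)‖ ^ 2 = ∑ i, x i ^ 2 := by
  simp [EuclideanSpace.norm_sq_eq]

theorem norm_toLp_antitone {N : ℕ} {p q : ℝ≥0∞} (hp : 1 ≤ p) (hpq : p ≤ q) (x : Fin N → ℝ) :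
    ‖(WithLp.toLp q x : PiLp q fun _ : Fin N => ℝ)‖ ≤
      ‖(WithLp.toLp p x : PiLp p fun _ : Fin N => ℝ)‖ := by
  have : Fact (1 ≤ p) := ⟨hp⟩
  have : Fact (1 ≤ q) := ⟨hp.trans hpq⟩
  set t := ‖(WithLp.toLp p x : PiLp p fun _ : Fin N => ℝ)‖ with ht
  have ht0 : 0 ≤ t := norm_nonneg _
  have hi : ∀ i, |x i| ≤ t := fun i => PiLp.norm_apply_le (WithLp.toLp p x) i
  rcases eq_or_ne q ∞ with rfl | hq
  · rw [PiLp.norm_eq_ciSup]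
    exact Real.iSup_le hi ht0
  have hp' : p ≠ ∞ := ne_top_of_le_ne_top hq hpq
  have hP := toReal_pos_of_one_le hp hp'
  have hQ := toReal_pos_of_one_le (hp.trans hpq) hq
  have hPQ : p.toReal ≤ q.toReal := ENNReal.toReal_mono hq hpq
  rw [← Real.rpow_le_rpow_iff (norm_nonneg _) ht0 hQ, norm_toLp_rpow hQ]
  calc ∑ i, |x i| ^ q.toReal ≤ ∑ i, t ^ (q.toReal - p.toReal) * |x i| ^ p.toReal := by
        refine Finset.sum_le_sum fun i _ => ?_
        have : |x i| ^ q.toReal = |x i| ^ (q.toReal - p.toReal) * |x i| ^ p.toReal := by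
          rw [← Real.rpow_add' (abs_nonneg _) (by linarith), sub_add_cancel]
        rw [this]
        gcongr
        exact hi i
    _ = t ^ (q.toReal - p.toReal) * t ^ p.toReal := by
        rw [← Finset.mul_sum, ht, norm_toLp_rpow hP]
    _ = t ^ q.toReal := by rw [← Real.rpow_add' ht0 (by linarith), sub_add_cancel]

theorem norm_toLp_le_norm_two {N : ℕ} {p : ℝ≥0∞} (hp : 1 ≤ p) (hp2 : p ≤ 2)
    (x : Fin N → ℝ) :
    ‖(WithLp.toLp p x : PiLp p fun _ : Fin N => ℝ)‖ ≤
      (N : ℝ) ^ (1 / p.toReal - 1 / 2) * ‖(WithLp.toLp 2 x : PiLp 2 fun _ : Fin N => ℝ)‖ := by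
  have : Fact (1 ≤ p) := ⟨hp⟩
  have hp' : p ≠ ∞ := ne_top_of_le_ne_top (by norm_num) hp2
  have hP := toReal_pos_of_one_le hp hp'
  have hP2 : p.toReal ≤ 2 := by
    have := ENNReal.toReal_mono (by norm_num) hp2
    simpa using this
  refine abs_le_of_sq_le_sq' ?_ (by positivity) |>.2
  have h := Real.rpow_sum_le_const_mul_sum_rpow_of_nonneg Finset.univ
    (f := fun i => |x i| ^ p.toReal) (p := 2 / p.toReal) ((one_le_div hP).2 hP2)
    (fun _ _ => by positivity)
  rw [← norm_toLp_rpow hP, ← Real.rpow_mul (norm_nonneg _), mul_div_cancel₀ _ hP.ne',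
    Real.rpow_two, Finset.card_univ, Fintype.card_fin] at h
  have e : ∑ i, (|x i| ^ p.toReal) ^ (2 / p.toReal) =
      ‖(WithLp.toLp 2 x : PiLp 2 fun _ : Fin N => ℝ)‖ ^ 2 := by
    rw [norm_toLp_two_sq]
    refine Finset.sum_congr rfl fun i _ => ?_
    rw [← Real.rpow_mul (abs_nonneg _), mul_div_cancel₀ _ hP.ne', Real.rpow_two, sq_abs]
  rw [e] at h
  rw [mul_pow, ← Real.rpow_natCast ((N : ℝ) ^ _), ← Real.rpow_mul (by positivity)]
  have e' : (1 / p.toReal - 1 / 2) * ((2 : ℕ) : ℝ) = 2 / p.toReal - 1 := by push_cast; ring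
  rw [e']
  exact h

theorem mem_smul_lpUnitBall {N : ℕ} {p : ℝ≥0∞} (hp : 1 ≤ p) {c : ℝ} (hc : 0 < c)
    {x : Fin N → ℝ} :
    x ∈ c • lpUnitBall N p ↔ ‖(WithLp.toLp p x : PiLp p fun _ : Fin N => ℝ)‖ ≤ c := by
  have : Fact (1 ≤ p) := ⟨hp⟩
  rw [Set.mem_smul_set_iff_inv_smul_mem₀ hc.ne', lpUnitBall, Set.mem_ofPred_eq, WithLp.toLp_smul,
    norm_smul, Real.norm_of_nonneg (by positivity), inv_mul_le_iff₀ hc, mul_one]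

theorem mem_ballsInter {ι : Type*} {N : ℕ} {q : ℝ≥0∞} {p : ι → ℝ≥0∞} {ν : ι → ℝ}
    (hp : ∀ j, 1 ≤ p j) (hν : ∀ j, 0 < ν j) {x : PiLp q fun _ : Fin N => ℝ} :
    x ∈ ballsInter N q p ν ↔
      ∀ j, ‖(WithLp.toLp (p j) (WithLp.ofLp x) : PiLp (p j) fun _ : Fin N => ℝ)‖ ≤ ν j := by
  rw [ballsInter, Set.mem_ofPred_eq, Set.mem_iInter]
  exact forall_congr' fun j => mem_smul_lpUnitBall (hp j) (hν j)

theorem toReal_one_div_conjExponent {p : ℝ≥0∞} (hp : 1 < p) :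
    (1 / ENNReal.conjExponent p).toReal = 1 - 1 / p.toReal := by
  have h := (ENNReal.HolderConjugate.conjExponent hp.le).inv_add_inv_eq_one
  have h2 : p⁻¹ ≤ 1 := ENNReal.inv_le_one.2 hp.le
  have h3 : (ENNReal.conjExponent p)⁻¹ = 1 - p⁻¹ :=
    ENNReal.eq_sub_of_add_eq (ne_top_of_le_ne_top ENNReal.one_ne_top h2) (by rw [add_comm]; exact h)
  rw [one_div, h3, ENNReal.toReal_sub_of_le h2 ENNReal.one_ne_top, ENNReal.toReal_inv,
    ENNReal.toReal_one, one_div]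

/-- Positivity of `ν₁` and `N` matters: in `[0, ∞]` a zero factor would turn the product into 0. -/
theorem widthRate_zero {N : ℕ} (hN : 0 < N) (p₁ : ℝ≥0∞) {ν₁ : ℝ} (hν : 0 < ν₁) (νr : ℝ) :
    widthRate 0 N p₁ ν₁ νr = ENNReal.ofReal νr := by
  have h1 : ENNReal.ofReal ν₁ ≠ 0 := by simpa using hν
  have h2 : (N : ℝ≥0∞) ^ (1 / ENNReal.conjExponent p₁).toReal ≠ 0 := by
    rw [Ne, ENNReal.rpow_eq_zero_iff]
    have : (N : ℝ≥0∞) ≠ 0 := by exact_mod_cast hN.ne'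
    simp [this]
  rw [widthRate, Nat.cast_zero, ENNReal.zero_rpow_of_neg (by norm_num), ENNReal.mul_top h1,
    ENNReal.top_mul h2, min_eq_right le_top]

theorem widthRate_of_pos {n N : ℕ} (hn : 0 < n) (hN : 0 < N) {p₁ : ℝ≥0∞} (hp : 1 < p₁) {ν₁ : ℝ}
    (hν : 0 < ν₁) (νr : ℝ) :
    widthRate n N p₁ ν₁ νr =
      ENNReal.ofReal (min (ν₁ * (N : ℝ) ^ (1 - 1 / p₁.toReal) / √n) νr) := by
  have hn0 : (0 : ℝ) < n := by exact_mod_cast hn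
  have hN0 : (0 : ℝ) < N := by exact_mod_cast hN
  rw [widthRate, toReal_one_div_conjExponent hp, ENNReal.ofReal_min]
  congr 1
  rw [← ENNReal.ofReal_natCast n, ← ENNReal.ofReal_natCast N, ENNReal.ofReal_rpow_of_pos hn0,
    ENNReal.ofReal_rpow_of_pos hN0, ← ENNReal.ofReal_mul hν.le, ← ENNReal.ofReal_mul (by positivity)]
  congr 1
  rw [Real.rpow_neg hn0.le, ← Real.sqrt_eq_rpow]
  ring

/-! ### Spread vectors in subspaces of small codimension. -/

/-- A subspace of codimension at most `n` has a small component orthogonal to it in the direction of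
some coordinate vector. -/
theorem exists_norm_starProjection_single_sq_le {n N : ℕ} (hN : 0 < N)
    (U : Submodule ℝ (EuclideanSpace ℝ (Fin N))) (hU : Module.finrank ℝ U ≤ n) :
    ∃ i, U.starProjection (EuclideanSpace.single i 1) i ≤ n / N ∧
      ‖U.starProjection (EuclideanSpace.single i 1)‖ ^ 2 =
        U.starProjection (EuclideanSpace.single i 1) i := by
  have hN0 : (0 : ℝ) < N := by exact_mod_cast hN
  have hproj : LinearMap.IsProj U (U.starProjection : _ →ₗ[ℝ] EuclideanSpace ℝ (Fin N)) :=
    ⟨fun x => U.starProjection_apply_mem x,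
      fun x hx => Submodule.starProjection_eq_self_iff.2 hx⟩
  -- The trace of the projection is its rank, at most `n`, so some diagonal entry is at most the
  -- average `n / N`.
  have htr := hproj.trace
  rw [LinearMap.trace_eq_sum_inner _ (EuclideanSpace.basisFun (Fin N) ℝ)] at htr
  have : Nonempty (Fin N) := ⟨⟨0, hN⟩⟩
  obtain ⟨i, -, hi⟩ : ∃ i ∈ (Finset.univ : Finset (Fin N)),
      U.starProjection (EuclideanSpace.single i 1) i ≤ n / N := by
    refine Finset.exists_le_of_sum_le Finset.univ_nonempty ?_
    have e : ∑ i, U.starProjection (EuclideanSpace.single i (1 : ℝ)) i = Module.finrank ℝ U := by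
      rw [← htr]
      refine Finset.sum_congr rfl fun i _ => ?_
      simp [EuclideanSpace.inner_single_left]
    rw [e, Finset.sum_const, Finset.card_univ, Fintype.card_fin, nsmul_eq_mul,
      mul_div_cancel₀ _ hN0.ne']
    exact_mod_cast hU
  refine ⟨i, hi, ?_⟩
  have h := U.re_inner_starProjection_eq_normSq (EuclideanSpace.single i (1 : ℝ))
  rw [EuclideanSpace.inner_single_right] at h
  simp only [one_mul, RCLike.conj_to_real, RCLike.re_to_real] at h
  rw [h]
  rfl

/-- Every subspace cut out by `n ≤ N / 2` functionals contains a vector with a large coordinate whose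
`l_p`-norms are small. -/
theorem exists_spread_vector {n N : ℕ} (hN : 0 < N) (hn : (n : ℝ) ≤ N / 2)
    (φ : (Fin N → ℝ) →ₗ[ℝ] (Fin n → ℝ)) :
    ∃ (x : Fin N → ℝ) (i : Fin N), φ x = 0 ∧ 1 / 2 ≤ x i ∧
      (∀ p : ℝ≥0∞, 2 ≤ p → ‖(WithLp.toLp p x : PiLp p fun _ : Fin N => ℝ)‖ ≤ 2) ∧
      ∀ p : ℝ≥0∞, 1 ≤ p → p ≤ 2 → ‖(WithLp.toLp p x : PiLp p fun _ : Fin N => ℝ)‖ ≤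
        1 + (N : ℝ) ^ (1 / p.toReal - 1) * √n := by
  have hN0 : (0 : ℝ) < N := by exact_mod_cast hN
  let ψ : EuclideanSpace ℝ (Fin N) →ₗ[ℝ] (Fin n → ℝ) :=
    φ ∘ₗ (WithLp.linearEquiv 2 ℝ (Fin N → ℝ)).toLinearMap
  have hrank : Module.finrank ℝ (LinearMap.ker ψ)ᗮ ≤ n := by
    have h1 := (LinearMap.ker ψ).finrank_add_finrank_orthogonal
    have h2 := LinearMap.finrank_range_add_finrank_ker ψ
    have h3 : Module.finrank ℝ (LinearMap.range ψ) ≤ n := by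
      simpa using Submodule.finrank_le (LinearMap.range ψ)
    omega
  obtain ⟨i, hi, hnorm⟩ := exists_norm_starProjection_single_sq_le hN _ hrank
  set w := (LinearMap.ker ψ)ᗮ.starProjection (EuclideanSpace.single i 1) with hw
  have hwker : EuclideanSpace.single i 1 - w ∈ LinearMap.ker ψ := by
    have := (LinearMap.ker ψ)ᗮ.sub_starProjection_mem_orthogonal (EuclideanSpace.single i (1 : ℝ))
    rwa [Submodule.orthogonal_orthogonal] at this
  have hhalf : (n : ℝ) / N ≤ 1 / 2 := by rw [div_le_iff₀ hN0]; linarith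
  have hw2 : ‖w‖ ≤ √n / √N := by
    rw [← Real.sqrt_div (by positivity)]
    exact Real.le_sqrt_of_sq_le (hnorm.trans_le hi)
  have htri : ∀ p : ℝ≥0∞, 1 ≤ p →
      ‖(WithLp.toLp p (Pi.single i 1 - WithLp.ofLp w) : PiLp p fun _ : Fin N => ℝ)‖ ≤
        1 + ‖(WithLp.toLp p (WithLp.ofLp w) : PiLp p fun _ : Fin N => ℝ)‖ := by
    intro p hp
    have : Fact (1 ≤ p) := ⟨hp⟩
    rw [WithLp.toLp_sub]
    refine (norm_sub_le _ _).trans_eq ?_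
    rw [PiLp.toLp_single, PiLp.norm_single, norm_one]
  refine ⟨Pi.single i 1 - WithLp.ofLp w, i, LinearMap.mem_ker.1 hwker, ?_, fun p hp => ?_, fun p hp hp2 => ?_⟩
  · simp only [Pi.sub_apply, Pi.single_eq_same]
    linarith
  · refine (norm_toLp_antitone one_le_two hp _).trans ((htri 2 one_le_two).trans ?_)
    have h1 : ‖w‖ ≤ 1 := by
      refine abs_le_of_sq_le_sq' ?_ zero_le_one |>.2
      rw [hnorm]
      linarith
    change 1 + ‖w‖ ≤ 2
    linarith
  · refine (htri p hp).trans ?_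
    gcongr
    refine (norm_toLp_le_norm_two hp hp2 _).trans ?_
    calc _ ≤ (N : ℝ) ^ (1 / p.toReal - 1 / 2) * (√n / √N) := by gcongr
      _ = _ := by
        have : (N : ℝ) ^ (1 / p.toReal - 1 / 2) =
            (N : ℝ) ^ (1 / p.toReal - 1) * √N := by
          rw [Real.sqrt_eq_rpow, ← Real.rpow_add hN0]; congr 1; ring
        have hs : √(N : ℝ) ≠ 0 := (Real.sqrt_pos.2 hN0).ne'
        rw [this]
        field_simp

/-! ### The two bounds for the width. -/

/-- There are `n` functionals on `l_q^N`, `q ≥ 2`, on whose common kernel the `l_q`-norm is at most a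
multiple of `n^{-1/2} N^{1/p'}` times the `l_p`-norm. -/
theorem exists_functionals_norm_le {p₁ : ℝ≥0∞} (hp₁ : 1 < p₁) (hp₂ : p₁ < 2) :
    ∃ D : ℝ, 0 < D ∧ ∀ (q : ℝ≥0∞) [Fact (1 ≤ q)] (n N : ℕ), 2 ≤ q → 0 < n → n ≤ N →
      ∃ f : Fin n → StrongDual ℝ (PiLp q fun _ : Fin N => ℝ),
        ∀ (x : PiLp q fun _ : Fin N => ℝ) (ν : ℝ), (∀ k, f k x = 0) → 0 < ν →
          ‖(WithLp.toLp p₁ (WithLp.ofLp x) : PiLp p₁ fun _ : Fin N => ℝ)‖ ≤ ν →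
          ‖x‖ ≤ D * (ν * (N : ℝ) ^ (1 - 1 / p₁.toReal) / √n) := by
  have htop : p₁ ≠ ∞ := (hp₂.trans (by norm_num)).ne
  have hP1 : 1 < p₁.toReal := by
    simpa using (ENNReal.toReal_lt_toReal ENNReal.one_ne_top htop).2 hp₁
  have hP2 : p₁.toReal < 2 := by
    simpa using (ENNReal.toReal_lt_toReal htop (by norm_num)).2 hp₂
  have hP0 : 0 < p₁.toReal := by linarith
  have hθ0 : 0 < 1 - 1 / p₁.toReal := by
    rw [sub_pos, div_lt_one hP0]; exact hP1
  have hθ1 : 1 - 1 / p₁.toReal < 1 := by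
    have : 0 < 1 / p₁.toReal := by positivity
    linarith
  obtain ⟨c, C, hc, hC, hA⟩ := exists_signMap_bounds hθ0 hθ1
  obtain ⟨D, hD, hbound⟩ := sum_sq_le_of_bounds hP1 hP2 rfl hc hC
  refine ⟨√D, Real.sqrt_pos.2 hD, fun q _ n N hq hn hnN => ?_⟩
  have hn0 : (0 : ℝ) < n := by exact_mod_cast hn
  obtain ⟨A, hU, hL⟩ := hA n N hn hnN
  refine ⟨fun k => LinearMap.toContinuousLinearMap
    ((EuclideanSpace.proj k : StrongDual ℝ (EuclideanSpace ℝ (Fin n))).toLinearMap ∘ₗ signMap A ∘ₗ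
      (WithLp.linearEquiv q ℝ (Fin N → ℝ)).toLinearMap), fun x ν hx hν hxν => ?_⟩
  set y := WithLp.ofLp x with hy
  have hΛ : signMap A y = 0 := by
    ext k
    exact hx k
  have hsum : ∑ i, |(ν⁻¹ • y) i| ^ p₁.toReal ≤ 1 := by
    have : Fact (1 ≤ p₁) := ⟨hp₁.le⟩
    rw [← norm_toLp_rpow hP0, WithLp.toLp_smul, norm_smul, Real.norm_of_nonneg (by positivity)]
    refine Real.rpow_le_one (by positivity) ?_ hP0.le
    rwa [inv_mul_le_iff₀ hν, mul_one]
  have h := hbound n N hn hnN _ (signMap A) hU hL (ν⁻¹ • y) hsum (by rw [map_smul, hΛ, smul_zero])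
  have h2 : ‖(WithLp.toLp 2 y : PiLp 2 fun _ : Fin N => ℝ)‖ ≤
      √D * (ν * (N : ℝ) ^ (1 - 1 / p₁.toReal) / √n) := by
    refine abs_le_of_sq_le_sq' ?_ (by positivity) |>.2
    have e : ∑ i, (ν⁻¹ • y) i ^ 2 = (ν ^ 2)⁻¹ * ∑ i, y i ^ 2 := by
      rw [Finset.mul_sum]
      refine Finset.sum_congr rfl fun i _ => ?_
      rw [Pi.smul_apply, smul_eq_mul, mul_pow, inv_pow]
    rw [norm_toLp_two_sq, mul_pow, div_pow, mul_pow, Real.sq_sqrt hD.le, Real.sq_sqrt hn0.le,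
      ← mul_div_assoc, le_div_iff₀ hn0]
    rw [e] at h
    calc (∑ i, y i ^ 2) * n = ν ^ 2 * (n * ((ν ^ 2)⁻¹ * ∑ i, y i ^ 2)) := by field_simp
      _ ≤ ν ^ 2 * (D * ((N : ℝ) ^ (1 - 1 / p₁.toReal)) ^ 2) := by gcongr
      _ = _ := by ring
  exact (norm_toLp_antitone one_le_two hq y).trans h2

theorem gelfandWidth_le_of_functionals {X : Type*} [NormedAddCommGroup X] [NormedSpace ℝ X] {n : ℕ}
    {M : Set X} {R : ℝ} (f : Fin n → StrongDual ℝ X)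
    (h : ∀ x ∈ M, (∀ k, f k x = 0) → ‖x‖ ≤ R) : gelfandWidth n M ≤ ENNReal.ofReal R := by
  refine (iInf_le _ f).trans (iSup₂_le fun x hx => ?_)
  rw [← ofReal_norm]
  exact ENNReal.ofReal_le_ofReal (h x hx.1 hx.2)

theorem le_gelfandWidth {X : Type*} [NormedAddCommGroup X] [NormedSpace ℝ X] {n : ℕ}
    {M : Set X} {R : ℝ}
    (h : ∀ f : Fin n → StrongDual ℝ X, ∃ x ∈ M, (∀ k, f k x = 0) ∧ R ≤ ‖x‖) :
    ENNReal.ofReal R ≤ gelfandWidth n M := by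
  refine le_iInf fun f => ?_
  obtain ⟨x, hxM, hxf, hx⟩ := h f
  refine le_iSup₂_of_le x ⟨hxM, hxf⟩ ?_
  rw [← ofReal_norm]
  exact ENNReal.ofReal_le_ofReal hx

/-- The lower bound: `R` is any number with `R ≤ ν_r` and `R n^{1/2} ≤ ν_1 N^{1/p_1'}`. -/
theorem le_gelfandWidth_ballsInter {q : ℝ≥0∞} [Fact (1 ≤ q)] {r N n : ℕ}
    {p : Fin (r + 1) → ℝ≥0∞} {ν : Fin (r + 1) → ℝ} (hp : ∀ j, 1 ≤ p j)
    (hν : ∀ j, 0 < ν j) (hanti : Antitone ν)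
    (hmono : Monotone fun j => ν j * (N : ℝ) ^ (-(1 / p j).toReal))
    (hN : 0 < N) (hn : (n : ℝ) ≤ N / 2) {R : ℝ} (hR : 0 ≤ R) (hRr : R ≤ ν (Fin.last r))
    (hR1 : R * √n ≤ ν 0 * (N : ℝ) ^ (1 - 1 / (p 0).toReal)) :
    ENNReal.ofReal (1 / 4 * R) ≤ gelfandWidth n (ballsInter N q p ν) := by
  have hN0 : (0 : ℝ) < N := by exact_mod_cast hN
  refine le_gelfandWidth fun f => ?_
  obtain ⟨x, i, hφ, hxi, hx2, hx1⟩ := exists_spread_vector hN hn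
    (LinearMap.pi fun k => (f k).toLinearMap ∘ₗ
      (WithLp.linearEquiv q ℝ (Fin N → ℝ)).symm.toLinearMap)
  have hker : ∀ k, f k (WithLp.toLp q x) = 0 := fun k => congrFun hφ k
  -- The factor 1/2 absorbs the norm bound 2 and the two summands of the bound for `p ≤ 2`; the
  -- coordinate at least 1/2 then leaves `R / 4`.
  refine ⟨(R / 2) • WithLp.toLp q x, ?_, fun k => by rw [map_smul, hker, smul_zero], ?_⟩
  · rw [mem_ballsInter hp hν]
    intro j
    have : Fact (1 ≤ p j) := ⟨hp j⟩
    rw [WithLp.ofLp_smul, WithLp.toLp_smul, norm_smul, Real.norm_of_nonneg (by positivity)]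
    have hRj : R ≤ ν j := hRr.trans (hanti (Fin.le_last j))
    rcases le_total 2 (p j) with h | h
    · nlinarith [hx2 (p j) h]
    · have h1 := hx1 (p j) (hp j) h
      -- The ordering of `ν_j N^{-1/p_j}` carries the constraint from the first ball to the `j`-th.
      have h2 : R * ((N : ℝ) ^ (1 / (p j).toReal - 1) * √n) ≤ ν j := by
        have hm := hmono (Fin.zero_le j)
        simp only [ENNReal.toReal_div, ENNReal.toReal_one] at hm
        calc R * ((N : ℝ) ^ (1 / (p j).toReal - 1) * √n)
            = (R * √n) * (N : ℝ) ^ (1 / (p j).toReal - 1) := by ring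
          _ ≤ (ν 0 * (N : ℝ) ^ (1 - 1 / (p 0).toReal)) * (N : ℝ) ^ (1 / (p j).toReal - 1) := by
              gcongr
          _ = (ν 0 * (N : ℝ) ^ (-(1 / (p 0).toReal))) * (N : ℝ) ^ (1 / (p j).toReal) := by
              rw [mul_assoc, mul_assoc, ← Real.rpow_add hN0, ← Real.rpow_add hN0]
              congr 2; ring
          _ ≤ (ν j * (N : ℝ) ^ (-(1 / (p j).toReal))) * (N : ℝ) ^ (1 / (p j).toReal) := by
              gcongr
          _ = ν j := by rw [mul_assoc, ← Real.rpow_add hN0]; simp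
      calc _ ≤ R / 2 * (1 + (N : ℝ) ^ (1 / (p j).toReal - 1) * √n) := by gcongr
        _ ≤ ν j := by linarith
  · rw [norm_smul, Real.norm_of_nonneg (by positivity)]
    have h1 : x i ≤ ‖WithLp.toLp q x‖ :=
      (le_abs_self _).trans (PiLp.norm_apply_le (WithLp.toLp q x) i)
    nlinarith

/-- The balls are indexed by `Fin (r + 1)`, so `p 0`, `ν 0` belong to the first ball and
`p (Fin.last r)`, `ν (Fin.last r)` to the last one. The constants depend on `p₁` only. -/
theorem theorem1 (p₁ : ℝ≥0∞) (hp₁ : 1 < p₁) (hp₁' : p₁ < 2) :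
    ∃ c C : ℝ, 0 < c ∧ 0 < C ∧
      ∀ (q : ℝ≥0∞) [Fact (1 ≤ q)] (r N n : ℕ) (p : Fin (r + 1) → ℝ≥0∞) (ν : Fin (r + 1) → ℝ),
        2 ≤ q →
        p 0 = p₁ → Monotone p → p (Fin.last r) ≤ q →
        (∀ j, 0 < ν j) → Antitone ν →
        Monotone (fun j => ν j * (N : ℝ) ^ (-(1 / p j).toReal)) →
        0 < N → (n : ℝ) ≤ (N : ℝ) / 2 →
          ENNReal.ofReal c * widthRate n N p₁ (ν 0) (ν (Fin.last r))
              ≤ gelfandWidth n (ballsInter N q p ν) ∧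
          gelfandWidth n (ballsInter N q p ν)
              ≤ ENNReal.ofReal C * widthRate n N p₁ (ν 0) (ν (Fin.last r)) := by
  obtain ⟨D, hD, hfun⟩ := exists_functionals_norm_le hp₁ hp₁'
  -- `D` serves the kernel estimate; the added 1 covers the trivial bound `ν_r`.
  refine ⟨1 / 4, D + 1, by norm_num, by positivity, ?_⟩
  intro q _ r N n p ν hq hp0 hpmono hpq hν hanti hmono hN hn
  have hN0 : (0 : ℝ) < N := by exact_mod_cast hN
  have hp : ∀ j, 1 ≤ p j := fun j => hp₁.le.trans (hp0 ▸ hpmono (Fin.zero_le j))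
  have hνr := hν (Fin.last r)
  have htriv : ∀ x ∈ ballsInter N q p ν, ‖x‖ ≤ ν (Fin.last r) := fun x hx =>
    (norm_toLp_antitone (hp _) hpq (WithLp.ofLp x)).trans ((mem_ballsInter hp hν).1 hx _)
  rcases Nat.eq_zero_or_pos n with rfl | hn0
  · rw [widthRate_zero hN p₁ (hν 0), ← ENNReal.ofReal_mul (by norm_num),
      ← ENNReal.ofReal_mul (by positivity)]
    constructor
    · refine le_gelfandWidth_ballsInter hp hν hanti hmono hN hn hνr.le le_rfl ?_
      have := hν 0
      simp only [Nat.cast_zero, Real.sqrt_zero, mul_zero]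
      positivity
    · refine gelfandWidth_le_of_functionals 0 fun x hx _ => (htriv x hx).trans ?_
      nlinarith
  · have hnR : (0 : ℝ) < n := by exact_mod_cast hn0
    have hnN : n ≤ N := by
      have : (n : ℝ) ≤ N := by linarith
      exact_mod_cast this
    have hν0 := hν 0
    rw [widthRate_of_pos hn0 hN hp₁ hν0, ← ENNReal.ofReal_mul (by norm_num),
      ← ENNReal.ofReal_mul (by positivity)]
    set R₁ := ν 0 * (N : ℝ) ^ (1 - 1 / p₁.toReal) / √n with hR₁
    have hR₁0 : 0 < R₁ := by positivity
    constructor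
    · refine le_gelfandWidth_ballsInter hp hν hanti hmono hN hn (by positivity) (min_le_right _ _) ?_
      rw [hp0, ← le_div_iff₀ (Real.sqrt_pos.2 hnR)]
      exact min_le_left _ _
    · obtain ⟨f, hf⟩ := hfun q n N hq hn0 hnN
      refine gelfandWidth_le_of_functionals f fun x hx hxf => ?_
      have h1 := hf x (ν 0) hxf hν0 (hp0 ▸ (mem_ballsInter hp hν).1 hx 0)
      have h2 := htriv x hx
      rw [← hR₁] at h1
      rcases min_cases R₁ (ν (Fin.last r)) with ⟨h, -⟩ | ⟨h, -⟩ <;> rw [h] <;> nlinarith
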